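/- Let $J$ be a smooth manifold (Hausdorff, second countable, without boundary) with a smooth involution $\iota_J$ whose fixed point set is nonempty and consists of isolated points. Fix a regularity class $r\in\{0,1,2,\dots,\infty\}$; all bundles, lifts and isomorphisms below are of class $C^r$ (so $r=0$ is the case of topological bundles and $r=\infty$ the case of smooth bundles). A quaternionic bundle over $J$ is a complex vector bundle $E\to J$ together with a lift $\iota_E:E\to E$ of $\iota_J$ which is additive and anti-complex on the fibres ($\iota_E(zv)=\bar z\,\iota_E(v)$ for $z\in\mathbb C$) and satisfies $\iota_E\circ\iota_E=-1$; its rank is its rank as a complex vector bundle. An isomorphism of quaternionic bundles is an isomorphism of complex vector bundles over $J$ that commutes with the lifts of $\iota_J$. Let $\underline{\mathbb H}^{l}$ denote the rank $2l$ quaternionic bundle $J\times\mathbb H^{l}$ with lift $(x,q)\mapsto(\iota_J x,q\mathbf j)$, where $\mathbb H$ is regarded as a complex vector space by right multiplication, $z\cdot q=qz$. Suppose that $J$ has dimension $4n-\mu$ with integers $n\ge 0$ and $0\le\mu\le 3$, and that $E$ is a quaternionic bundle over $J$ of rank $2m\ge 2n$. Then there is a quaternionic bundle $Q$ over $J$ of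 rank $2n$ such that $E$ is isomorphic, as a quaternionic bundle, to $Q\oplus\underline{\mathbb H}^{m-n}$. -/

import Mathlib

open Bundle
open scoped Manifold ContDiff Quaternion ComplexConjugate

universe u v w

noncomputable section

/-! ### The complex vector space underlying the quaternions -/

/-- The quaternions, regarded as a complex vector space by *right* multiplication by complex
numbers: `z • q = q * z`. For this complex structure right multiplication by `j` is anti-complex. -/
def RightQuaternion : Type := ℍ

namespace RightQuaternion

instance : NormedAddCommGroup RightQuaternion := inferInstanceAs (NormedAddCommGroup ℍ)

/-- A quaternion as an element of the right complex vector space of quaternions. -/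
def of (q : ℍ) : RightQuaternion := q

/-- The underlying quaternion. -/
def val (q : RightQuaternion) : ℍ := q

instance : SMul ℂ RightQuaternion := ⟨fun z q => of (q.val * (z : ℍ))⟩

theorem smul_def (z : ℂ) (q : RightQuaternion) : z • q = of (q.val * (z : ℍ)) := rfl

instance : Module ℂ RightQuaternion where
  one_smul q := mul_one q.val
  mul_smul z w q := by
    change q.val * ((z * w : ℂ) : ℍ) = q.val * (w : ℍ) * (z : ℍ)
    rw [mul_comm z w, Quaternion.coeComplex_mul, mul_assoc]
  smul_zero z := zero_mul (z : ℍ)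
  smul_add z p q := add_mul p.val q.val (z : ℍ)
  add_smul z w q := by
    change q.val * ((z + w : ℂ) : ℍ) = q.val * (z : ℍ) + q.val * (w : ℍ)
    rw [Quaternion.coeComplex_add, mul_add]
  zero_smul q := by
    change q.val * ((0 : ℂ) : ℍ) = 0
    rw [Quaternion.coeComplex_zero, mul_zero]

theorem norm_coeComplex (z : ℂ) : ‖(z : ℍ)‖ = ‖z‖ := by
  have h : ‖(z : ℍ)‖ * ‖(z : ℍ)‖ = ‖z‖ * ‖z‖ := by
    rw [← Quaternion.normSq_eq_norm_mul_self, Quaternion.normSq_def', Complex.norm_mul_self_eq_normSq,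
      Complex.normSq_apply]
    simp
    ring
  exact (mul_self_inj (norm_nonneg _) (norm_nonneg _)).1 h

instance : NormedSpace ℂ RightQuaternion where
  norm_smul_le z q := by
    change ‖q.val * (z : ℍ)‖ ≤ ‖z‖ * ‖q.val‖
    rw [norm_mul, norm_coeComplex, mul_comm]

/-- The quaternion `j`. -/
def unitJ : ℍ := ⟨0, 0, 1, 0⟩

@[simp] theorem re_unitJ : unitJ.re = 0 := rfl
@[simp] theorem imI_unitJ : unitJ.imI = 0 := rfl
@[simp] theorem imJ_unitJ : unitJ.imJ = 1 := rfl
@[simp] theorem imK_unitJ : unitJ.imK = 0 := rfl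

/-- Right multiplication by the quaternion `j`, an anti-complex map. -/
def mulJ : RightQuaternion →ₛₗ[starRingEnd ℂ] RightQuaternion where
  toFun q := of (q.val * unitJ)
  map_add' p q := add_mul p.val q.val _
  map_smul' z q := by
    change q.val * (z : ℍ) * unitJ
      = q.val * unitJ * ((conj z : ℂ) : ℍ)
    rw [mul_assoc, mul_assoc]
    congr 1
    ext <;> simp

theorem mulJ_mulJ (q : RightQuaternion) : mulJ (mulJ q) = -q := by
  change q.val * unitJ * unitJ = -q.val
  rw [mul_assoc, ← mul_neg_one q.val]
  congr 1
  ext <;> simp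

/-- `mulJ` as a continuous real linear map. -/
def mulJL : RightQuaternion →L[ℝ] RightQuaternion where
  toFun := mulJ
  map_add' := map_add mulJ
  map_smul' c q := by
    change mulJ ((c : ℂ) • q) = (c : ℂ) • mulJ q
    rw [LinearMap.map_smulₛₗ, Complex.conj_ofReal]
  cont := (continuous_mul_const unitJ : Continuous fun q : ℍ => q * unitJ)

end RightQuaternion

/-! ### Real vector bundle underlying a complex vector bundle -/

/-- A complex vector bundle is a real vector bundle. -/
instance VectorBundle.complexToReal {B F : Type*} {E : B → Type*} [TopologicalSpace B]
    [NormedAddCommGroup F] [NormedSpace ℂ F] [∀ x, AddCommGroup (E x)] [∀ x, Module ℂ (E x)]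
    [TopologicalSpace (TotalSpace F E)] [∀ x, TopologicalSpace (E x)] [FiberBundle F E]
    [VectorBundle ℂ F E] : VectorBundle ℝ F E where
  trivialization_linear' e _ :=
    { linear := fun b hb =>
        ((((Trivialization.linear ℂ e hb).mk' _).restrictScalars ℝ).isLinear) }
  continuousOn_coordChange' e e' _ _ := by
    have : e.IsLinear ℝ :=
      ⟨fun b hb => ((((Trivialization.linear ℂ e hb).mk' _).restrictScalars ℝ).isLinear)⟩
    have : e'.IsLinear ℝ :=
      ⟨fun b hb => ((((Trivialization.linear ℂ e' hb).mk' _).restrictScalars ℝ).isLinear)⟩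
    refine ((ContinuousLinearMap.restrictScalarsL ℂ F F ℝ ℝ).continuous.comp_continuousOn
      (continuousOn_coordChange ℂ e e')).congr fun b hb => ?_
    ext v
    change Trivialization.coordChangeL ℝ e e' b v = Trivialization.coordChangeL ℂ e e' b v
    rw [Trivialization.coordChangeL_apply _ _ hb, Trivialization.coordChangeL_apply _ _ hb]

/-! ### Quaternionic bundles -/

/-- A quaternionic vector bundle of class `C^r` with model fibre `F` over a `k`-dimensional manifold
`J` with a self-map `ι`: a complex vector bundle with a lift of `ι` to the total space which is
anti-complex on the fibres and whose square is `-1`. Here `r = 0` gives topological bundles and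
`r = ∞` smooth ones. -/
structure QuaternionicBundle {k : ℕ} {J : Type u} [TopologicalSpace J]
    [ChartedSpace (EuclideanSpace ℝ (Fin k)) J] (r : ℕ∞) (ι : J → J)
    (F : Type v) [NormedAddCommGroup F] [NormedSpace ℂ F] where
  /-- The fibres. -/
  Fiber : J → Type w
  [addCommGroup : ∀ x, AddCommGroup (Fiber x)]
  [module : ∀ x, Module ℂ (Fiber x)]
  [topologicalSpaceTotal : TopologicalSpace (TotalSpace F Fiber)]
  [topologicalSpace : ∀ x, TopologicalSpace (Fiber x)]
  [fiberBundle : FiberBundle F Fiber]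
  [vectorBundle : VectorBundle ℂ F Fiber]
  [contMDiffVectorBundle : ContMDiffVectorBundle r F Fiber (𝓡 k)]
  /-- The anti-complex lift of `ι`. -/
  lift : ∀ x, Fiber x →ₛₗ[starRingEnd ℂ] Fiber (ι x)
  contMDiff_lift : ContMDiff ((𝓡 k).prod 𝓘(ℝ, F)) ((𝓡 k).prod 𝓘(ℝ, F)) r
    (fun p : TotalSpace F Fiber => (⟨ι p.proj, lift p.proj p.2⟩ : TotalSpace F Fiber))
  lift_lift : ∀ x (a : Fiber x),
    (⟨ι (ι x), lift (ι x) (lift x a)⟩ : TotalSpace F Fiber) = ⟨x, -a⟩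

namespace QuaternionicBundle

attribute [instance] addCommGroup module topologicalSpaceTotal topologicalSpace fiberBundle
  vectorBundle contMDiffVectorBundle

variable {k : ℕ} {J : Type u} [TopologicalSpace J] [ChartedSpace (EuclideanSpace ℝ (Fin k)) J]
  {r : ℕ∞} {ι : J → J} {F : Type*} [NormedAddCommGroup F] [NormedSpace ℂ F]
  {F' : Type*} [NormedAddCommGroup F'] [NormedSpace ℂ F']

/-- The total space of a quaternionic bundle. -/
abbrev Total (E : QuaternionicBundle (k := k) r ι F) : Type _ := TotalSpace F E.Fiber

/-- An isomorphism of quaternionic bundles over `J`: a complex linear isomorphism on each fibre,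
of class `C^r` together with its inverse, which commutes with the lifts of `ι`. -/
structure Iso (E : QuaternionicBundle (k := k) r ι F) (E' : QuaternionicBundle (k := k) r ι F') where
  /-- The isomorphism on fibres. -/
  equiv : ∀ x, E.Fiber x ≃ₗ[ℂ] E'.Fiber x
  contMDiff_equiv : ContMDiff ((𝓡 k).prod 𝓘(ℝ, F)) ((𝓡 k).prod 𝓘(ℝ, F')) r
    (fun p : E.Total => (⟨p.proj, equiv p.proj p.2⟩ : E'.Total))
  contMDiff_symm : ContMDiff ((𝓡 k).prod 𝓘(ℝ, F')) ((𝓡 k).prod 𝓘(ℝ, F)) r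
    (fun p : E'.Total => (⟨p.proj, (equiv p.proj).symm p.2⟩ : E.Total))
  equiv_lift : ∀ x (a : E.Fiber x), equiv (ι x) (E.lift x a) = E'.lift x (equiv x a)

/-- The direct sum of two quaternionic bundles. -/
def prod (E : QuaternionicBundle (k := k) r ι F)
    (E' : QuaternionicBundle (k := k) r ι F') : QuaternionicBundle (k := k) r ι (F × F') where
  Fiber := E.Fiber ×ᵇ E'.Fiber
  addCommGroup x := inferInstanceAs (AddCommGroup (E.Fiber x × E'.Fiber x))
  module x := inferInstanceAs (Module ℂ (E.Fiber x × E'.Fiber x))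
  contMDiffVectorBundle := Bundle.Prod.contMDiffVectorBundle F E.Fiber F' E'.Fiber
  lift x :=
    { toFun := fun a => (E.lift x a.1, E'.lift x a.2)
      map_add' := fun a b => Prod.ext (map_add _ _ _) (map_add _ _ _)
      map_smul' := fun z a => Prod.ext (LinearMap.map_smulₛₗ _ _ _) (LinearMap.map_smulₛₗ _ _ _) }
  contMDiff_lift := by
    have h₁ : ContMDiff ((𝓡 k).prod 𝓘(ℝ, F × F')) ((𝓡 k).prod 𝓘(ℝ, F)) r
        (fun p : TotalSpace (F × F') (E.Fiber ×ᵇ E'.Fiber) => (⟨p.proj, p.2.1⟩ : E.Total)) := by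
      intro p
      have h := contMDiffAt_totalSpace.1
        (contMDiffAt_id (I := (𝓡 k).prod 𝓘(ℝ, F × F')) (n := r) (x := p))
      refine contMDiffAt_totalSpace.2 ⟨h.1, ?_⟩
      exact ((ContinuousLinearMap.fst ℝ F F').contMDiff (n := r)).contMDiffAt.comp
        (I' := 𝓘(ℝ, F × F')) p h.2
    have h₂ : ContMDiff ((𝓡 k).prod 𝓘(ℝ, F × F')) ((𝓡 k).prod 𝓘(ℝ, F')) r
        (fun p : TotalSpace (F × F') (E.Fiber ×ᵇ E'.Fiber) => (⟨p.proj, p.2.2⟩ : E'.Total)) := by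
      intro p
      have h := contMDiffAt_totalSpace.1
        (contMDiffAt_id (I := (𝓡 k).prod 𝓘(ℝ, F × F')) (n := r) (x := p))
      refine contMDiffAt_totalSpace.2 ⟨h.1, ?_⟩
      exact ((ContinuousLinearMap.snd ℝ F F').contMDiff (n := r)).contMDiffAt.comp
        (I' := 𝓘(ℝ, F × F')) p h.2
    intro p
    have k₁ := contMDiffAt_totalSpace.1 ((E.contMDiff_lift.comp h₁) p)
    have k₂ := contMDiffAt_totalSpace.1 ((E'.contMDiff_lift.comp h₂) p)
    exact contMDiffAt_totalSpace.2 ⟨k₁.1, k₁.2.prodMk_space k₂.2⟩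
  lift_lift x a := by
    have key : ∀ (y : J) (b : E.Fiber y) (c : E'.Fiber y), (⟨y, b⟩ : E.Total) = ⟨x, -a.1⟩ →
        (⟨y, c⟩ : E'.Total) = ⟨x, -a.2⟩ →
        (⟨y, (b, c)⟩ : TotalSpace (F × F') (E.Fiber ×ᵇ E'.Fiber)) = ⟨x, (-a.1, -a.2)⟩ := by
      intro y b c hb hc
      obtain rfl : y = x := congrArg TotalSpace.proj hb
      obtain rfl : b = -a.1 := TotalSpace.mk_inj.1 hb
      obtain rfl : c = -a.2 := TotalSpace.mk_inj.1 hc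
      rfl
    exact key _ _ _ (E.lift_lift x a.1) (E'.lift_lift x a.2)

/-- The trivial quaternionic bundle `J × ℍˡ`, with the lift `(x, q) ↦ (ι x, q j)`. -/
def trivial (hι : Function.Involutive ι) (hs : ContMDiff (𝓡 k) (𝓡 k) ∞ ι) (l : ℕ) :
    QuaternionicBundle (k := k) r ι (Fin l → RightQuaternion) where
  Fiber := Bundle.Trivial J (Fin l → RightQuaternion)
  addCommGroup x := inferInstanceAs (AddCommGroup (Fin l → RightQuaternion))
  module x := inferInstanceAs (Module ℂ (Fin l → RightQuaternion))
  contMDiffVectorBundle := Bundle.Trivial.contMDiffVectorBundle _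
  lift x :=
    { toFun := fun q i => RightQuaternion.mulJ (q i)
      map_add' := fun p q => funext fun i => map_add _ _ _
      map_smul' := fun z q => funext fun i => LinearMap.map_smulₛₗ _ _ _ }
  contMDiff_lift := by
    let L : (Fin l → RightQuaternion) →L[ℝ] (Fin l → RightQuaternion) :=
      ContinuousLinearMap.pi fun i => RightQuaternion.mulJL.comp (ContinuousLinearMap.proj i)
    intro p
    have h := contMDiffAt_totalSpace.1
      (contMDiffAt_id (I := (𝓡 k).prod 𝓘(ℝ, Fin l → RightQuaternion)) (n := r) (x := p))
    refine contMDiffAt_totalSpace.2 ⟨((hs.of_le (by exact_mod_cast le_top)) _).comp p h.1, ?_⟩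
    exact (L.contMDiff (n := r)).contMDiffAt.comp p h.2
  lift_lift x a := by
    have key : ∀ (y : J) (b c : Fin l → RightQuaternion), y = x → b = c →
        (⟨y, b⟩ : TotalSpace (Fin l → RightQuaternion)
          (Bundle.Trivial J (Fin l → RightQuaternion))) = ⟨x, c⟩ := by
      rintro y b c rfl rfl
      rfl
    exact key _ _ _ (hι x) (funext fun i => RightQuaternion.mulJ_mulJ _)

end QuaternionicBundle

end

/-! Put `l = m - n`. Splitting off the trivial summand of quaternionic rank `l` amounts to finding
`l` sections which, together with their conjugates under the lift, are linearly independent over `ℂ`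
at every point. Such a frame is the same as a fibrewise injective equivariant map from the trivial
bundle into `E`, and `Q` is then the kernel of an equivariant retraction onto the image.

The frame exists by general position. At a fixed point the lift makes the fibre a quaternionic
vector space of dimension `m`, so independent values exist there by linear algebra
(`exists_linearIndependent_sumElim_conj`). Since the fixed points are isolated, these values extend
to sections, and independence persists on a neighbourhood. Away from the fixed points the involution
is free: on a small set disjoint from its mirror image, a section and its conjugate can be changed
independently of each other, so equivariance imposes no constraint. There the frame is an arbitrary
family of `2l`-tuples in `ℂ^(2m)`. The dependent tuples have real codimension `2 * (2m - 2l + 1) =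
4n + 2`, which exceeds `dim J`, so a small perturbation avoids them
(`dense_setOf_forall_linearIndependent_add`). A locally finite sequence of such perturbations gives
the global frame (`exists_linearIndependent_frame`).

The retraction is built locally, glued by a partition of unity and averaged over the lift
(`exists_equivariant_retraction`). The kernel of a surjection onto a trivial bundle is a bundle of
class `C^r` (`TrivialQuotient`), and `nonempty_iso_bundle_prod_trivial` gives the splitting. -/

open scoped Topology

/-! ### General position for tuples of vectors. -/

open Module in
/-- If `P` is a `C¹` family of `κ`-tuples of vectors in a complex vector space `W`, parametrized by
a space whose dimension is less than the real codimension of the linearly dependent tuples, then a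
generic translate of `P` avoids the linearly dependent tuples. -/
theorem dense_setOf_forall_linearIndependent_add {κ Y W : Type*} [Fintype κ]
    [NormedAddCommGroup Y] [NormedSpace ℝ Y] [FiniteDimensional ℝ Y]
    [NormedAddCommGroup W] [NormedSpace ℂ W] [FiniteDimensional ℂ W]
    (hd : finrank ℝ Y + 2 * Fintype.card κ < 2 * finrank ℂ W + 2)
    {P : Y → κ → W} (hP : ContDiff ℝ 1 P) :
    Dense {A : κ → W | ∀ y, LinearIndependent ℂ (P y + A)} := by
  classical
  rcases isEmpty_or_nonempty κ with h | h
  · exact dense_univ.mono fun A _ y => linearIndependent_empty_type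
  have : FiniteDimensional ℝ W := FiniteDimensional.complexToReal W
  -- The range of `f j` contains every bad translate `A` for which the `j`-th vector of some `P y +
  -- A` is a combination of the others; the parameters are `y`, the coefficients and the other
  -- vectors of `P y + A`.
  let f (j : κ) : Y × ({i // i ≠ j} → ℂ) × ({i // i ≠ j} → W) → κ → W := fun p i =>
    if h : i = j then (∑ i', p.2.1 i' • p.2.2 i') - P p.1 i else p.2.2 ⟨i, h⟩ - P p.1 i
  have hf (j : κ) : ContDiff ℝ 1 (f j) := by
    have hP' (i : κ) : ContDiff ℝ 1
        fun p : Y × ({i // i ≠ j} → ℂ) × ({i // i ≠ j} → W) => P p.1 i :=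
      (contDiff_pi.1 hP i).comp contDiff_fst
    refine contDiff_pi.2 fun i => ?_
    by_cases h : i = j
    · simp only [f, h, dif_pos]
      refine ContDiff.sub (ContDiff.sum fun i' _ => ContDiff.smul ?_ ?_) (hP' j) <;> fun_prop
    · simp only [f, h, dif_neg, not_false_eq_true]
      exact ContDiff.sub (by fun_prop) (hP' i)
  -- A `C¹` image has Hausdorff dimension at most that of its source, here `dim Y + (2 + 2 dim
  -- W)(|κ| - 1)`. This is below `2 |κ| dim W` exactly by `hd`.
  have hdim (j : κ) : dimH (Set.range (f j)) < (finrank ℝ (κ → W) : ℕ) := by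
    refine (hf j).dimH_range_le.trans_lt ?_
    norm_cast
    have hpos : 1 ≤ Fintype.card κ := Fintype.card_pos_iff.2 ⟨j⟩
    have hW : finrank ℝ W = 2 * finrank ℂ W := finrank_real_of_complex W
    have hc : Fintype.card {i // i ≠ j} = Fintype.card κ - 1 := by
      simp [Fintype.card_subtype_compl]
    rw [Module.finrank_prod, Module.finrank_prod, Module.finrank_pi_fintype,
      Module.finrank_pi_fintype, Module.finrank_pi_fintype]
    simp only [Finset.sum_const, Finset.card_univ, hc, hW, smul_eq_mul,
      Complex.finrank_real_complex]
    obtain ⟨N, hN⟩ := Nat.exists_eq_add_of_le hpos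
    rw [hN] at hd ⊢
    rw [Nat.add_sub_cancel_left]
    nlinarith
  have hU : dimH (⋃ j, Set.range (f j)) < (finrank ℝ (κ → W) : ℕ) := by
    rw [dimH_iUnion]
    obtain ⟨j, hj⟩ := exists_eq_ciSup_of_finite (f := fun j => dimH (Set.range (f j)))
    rw [← hj]
    exact hdim j
  refine (dense_compl_of_dimH_lt_finrank hU).mono fun A hA y => ?_
  by_contra h
  rw [Fintype.not_linearIndependent_iff] at h
  obtain ⟨g, hg, j, hj⟩ := h
  refine hA (Set.mem_iUnion.2 ⟨j, (y, fun i => -(g i / g j), fun i => P y i + A i), ?_⟩)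
  ext i
  by_cases h : i = j
  · subst h
    simp only [f, dif_pos]
    rw [sub_eq_iff_eq_add, add_comm (A i)]
    rw [Fintype.sum_eq_add_sum_subtype_ne _ i] at hg
    apply smul_right_injective W hj
    have := eq_neg_of_add_eq_zero_left hg
    simp only [Pi.add_apply] at this
    simp only [this, Finset.smul_sum, ← Finset.sum_neg_distrib, smul_smul]
    refine Finset.sum_congr rfl fun i' _ => ?_
    rw [← neg_smul]
    congr 1
    field_simp
  · simp [f, h]

/-- A continuous family of tuples of vectors over a compact subset of a chart domain can be
approximated by a smooth family of linearly independent tuples, if the dimension of the manifold is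
less than the real codimension of the linearly dependent tuples. -/
theorem exists_contMDiffOn_dist_lt_linearIndependent {k : ℕ} {J : Type*} [TopologicalSpace J]
    [T2Space J] [ChartedSpace (EuclideanSpace ℝ (Fin k)) J] [IsManifold (𝓡 k) ∞ J]
    {κ W : Type*} [Fintype κ] [NormedAddCommGroup W] [NormedSpace ℂ W] [FiniteDimensional ℂ W]
    (hd : k + 2 * Fintype.card κ < 2 * Module.finrank ℂ W + 2) (c : J) {K : Set J}
    (hK : IsCompact K) (hKc : K ⊆ (chartAt (EuclideanSpace ℝ (Fin k)) c).source)
    {M : J → κ → W} (hM : ContinuousOn M K) {ε : ℝ} (hε : 0 < ε) :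
    ∃ P : J → κ → W,
      ContMDiffOn (𝓡 k) 𝓘(ℝ, κ → W) ∞ P (chartAt (EuclideanSpace ℝ (Fin k)) c).source ∧
      ∀ x ∈ K, dist (P x) (M x) < ε ∧ LinearIndependent ℂ (P x) := by
  have : FiniteDimensional ℝ W := FiniteDimensional.complexToReal W
  set φ := chartAt (EuclideanSpace ℝ (Fin k)) c
  have hφK : IsCompact (φ '' K) := hK.image_of_continuousOn (φ.continuousOn.mono hKc)
  have hcont : ContinuousOn (fun y => M (φ.symm y)) (φ '' K) := by
    refine hM.comp (φ.continuousOn_symm.mono ?_) ?_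
    · rintro _ ⟨x, hx, rfl⟩
      exact φ.map_source (hKc hx)
    · rintro _ ⟨x, hx, rfl⟩
      rwa [φ.left_inv (hKc hx)]
  -- Tietze extension to the whole Euclidean space, where smooth approximation is available. One
  -- half of `ε` pays for the approximation, the other for the generic translation.
  obtain ⟨g, hg⟩ := ContinuousMap.exists_restrict_eq hφK.isClosed
    ⟨(φ '' K).domRestrict fun y => M (φ.symm y), hcont.domRestrict⟩
  have hgM (x) (hx : x ∈ K) : g (φ x) = M x := by
    have := DFunLike.congr_fun hg ⟨φ x, x, hx, rfl⟩
    exact this.trans (congrArg M (φ.left_inv (hKc hx)))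
  obtain ⟨h, hh, hhg, -⟩ := g.continuous.exists_contDiff_approx (n := ⊤) (ε := fun _ => ε / 2)
    continuous_const (fun _ => half_pos hε)
  obtain ⟨A, hA, hAε⟩ := (dense_setOf_forall_linearIndependent_add (κ := κ) (W := W)
    (by simpa using hd) (hh.of_le (by simp))).exists_dist_lt 0 (half_pos hε)
  refine ⟨fun x => h (φ x) + A, ?_, fun x hx => ⟨?_, hA _⟩⟩
  · exact (hh.add contDiff_const).contMDiff.comp_contMDiffOn (contMDiffOn_chart)
  · have h1 := hhg (φ x)
    rw [hgM x hx] at h1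
    calc dist (h (φ x) + A) (M x) ≤ dist (h (φ x) + A) (h (φ x)) + dist (h (φ x)) (M x) :=
          dist_triangle _ _ _
      _ < ε / 2 + ε / 2 := by
          refine add_lt_add ?_ h1
          rwa [dist_self_add_left, ← dist_zero_left]
      _ = ε := add_halves ε

/-- A continuous family of tuples of vectors can be deformed, inside the support of a bump function
in a chart domain, to a family which is linearly independent where the bump function is `1`, while
keeping the linear independence over a given closed set. -/
theorem exists_contMDiffOn_linearIndependent_add_smul {k : ℕ} {J : Type*} [TopologicalSpace J]
    [T2Space J] [ChartedSpace (EuclideanSpace ℝ (Fin k)) J] [IsManifold (𝓡 k) ∞ J]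
    {κ W : Type*} [Fintype κ] [NormedAddCommGroup W] [NormedSpace ℂ W] [FiniteDimensional ℂ W]
    (hd : k + 2 * Fintype.card κ < 2 * Module.finrank ℂ W + 2) {c : J}
    (χ : SmoothBumpFunction (𝓡 k) c)
    {M : J → κ → W} (hM : ContinuousOn M (tsupport χ)) {C : Set J} (hC : IsClosed C)
    (hMC : ∀ x ∈ C ∩ tsupport χ, LinearIndependent ℂ (M x)) :
    ∃ P : J → κ → W,
      ContMDiffOn (𝓡 k) 𝓘(ℝ, κ → W) ∞ P (chartAt (EuclideanSpace ℝ (Fin k)) c).source ∧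
      ∀ x ∈ tsupport χ, x ∈ C ∨ χ x = 1 → LinearIndependent ℂ (M x + χ x • (P x - M x)) := by
  have hχ : IsCompact (tsupport χ) := χ.hasCompactSupport
  have himg : IsCompact (M '' (C ∩ tsupport χ)) :=
    (hχ.inter_left hC).image_of_continuousOn (hM.mono Set.inter_subset_right)
  have hsub : M '' (C ∩ tsupport χ) ⊆ {f : κ → W | LinearIndependent ℂ f} := by
    rintro _ ⟨x, hx, rfl⟩
    exact hMC x hx
  -- Independence is an open condition and the tuples over `C ∩ tsupport χ` form a compact set, so
  -- one `ε` protects them all. As `0 ≤ χ ≤ 1`, the deformation moves a tuple by less than `ε`;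
  -- where `χ = 1` it ends at `P`.
  obtain ⟨ε, hε, hthick⟩ := himg.exists_thickening_subset_open
    isOpen_setOfPred_linearIndependent hsub
  obtain ⟨P, hP, hPM⟩ := exists_contMDiffOn_dist_lt_linearIndependent hd c hχ
    χ.tsupport_subset_chartAt_source hM hε
  refine ⟨P, hP, fun x hx => ?_⟩
  rintro (hxC | hx1)
  · refine hthick (Metric.mem_thickening_iff.2 ⟨M x, ⟨x, ⟨hxC, hx⟩, rfl⟩, ?_⟩)
    rw [dist_self_add_left, norm_smul, Real.norm_of_nonneg χ.nonneg]
    refine lt_of_le_of_lt (mul_le_of_le_one_left (norm_nonneg _) χ.le_one) ?_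
    rw [← dist_eq_norm]
    exact (hPM x hx).1
  · rw [hx1, one_smul, add_sub_cancel]
    exact (hPM x hx).2

/-! ### Linear algebra of quaternionic structures. -/

/-- An injective antilinear map preserves independence, as do swapping the two halves and changing
signs. The swapped and signed tuple is the form that the frame of a tuple of sections takes at the
mirror point. -/
theorem linearIndependent_sumElim_neg_conj {ι V V' : Type*} [AddCommGroup V] [Module ℂ V]
    [AddCommGroup V'] [Module ℂ V'] (f : V →ₛₗ[starRingEnd ℂ] V') (hf : Function.Injective f)
    {u w : ι → V} (h : LinearIndependent ℂ (Sum.elim u w)) :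
    LinearIndependent ℂ (Sum.elim (fun i => -f (w i)) fun i => f (u i)) := by
  have h1 : LinearIndependent ℂ fun a => f (Sum.elim u w a) :=
    h.map_of_injective_injectiveₛ (starRingEnd ℂ) f.toAddMonoidHom star_injective hf fun z v =>
      (f.map_smulₛₗ _ _).trans (by rw [Complex.conj_conj]; rfl)
  have h2 := (h1.comp _ (Equiv.sumComm ι ι).injective).units_smul
    (Sum.elim (fun _ => -1) fun _ => 1)
  convert h2 using 1
  ext (i | i) <;> simp

/-- A complex vector space with a quaternionic structure contains quaternionically independent
tuples of any length allowed by the dimension. -/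
theorem exists_linearIndependent_sumElim_conj {V : Type*} [AddCommGroup V] [Module ℂ V]
    [FiniteDimensional ℂ V] (f : V →ₛₗ[starRingEnd ℂ] V) (hf : ∀ v, f (f v) = -v) (l : ℕ)
    (hl : 2 * l ≤ Module.finrank ℂ V) :
    ∃ v : Fin l → V, LinearIndependent ℂ (Sum.elim v fun i => f (v i)) := by
  induction l with
  | zero => exact ⟨Fin.elim0, linearIndependent_empty_type⟩
  | succ l ih =>
    obtain ⟨v, hv⟩ := ih (by omega)
    set S := Submodule.span ℂ (Set.range (Sum.elim v fun i => f (v i))) with hS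
    have hSv (i) : v i ∈ S := Submodule.subset_span ⟨Sum.inl i, rfl⟩
    have hSf (i) : f (v i) ∈ S := Submodule.subset_span ⟨Sum.inr i, rfl⟩
    have hinv : ∀ x ∈ S, f x ∈ S := by
      intro x hx
      induction hx using Submodule.span_induction with
      | mem x h =>
        obtain ⟨i | i, rfl⟩ := h
        · exact hSf i
        · simpa [hf] using hSv i
      | zero => simp
      | add x y _ _ h1 h2 => simpa using S.add_mem h1 h2
      | smul a x _ h => simpa [LinearMap.map_smulₛₗ] using S.smul_mem _ h
    have hne : S ≠ ⊤ := by
      intro h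
      have h1 := finrank_span_eq_card hv
      rw [← hS, h, finrank_top] at h1
      simp at h1
      omega
    obtain ⟨x, hx⟩ : ∃ x, x ∉ S := by
      by_contra! h
      exact hne (eq_top_iff.2 fun x _ => h x)
    -- Since `S` is stable under `f`, applying `f` gives a second relation. Eliminating `f x` leaves
    -- `(|a|² + |b|²) • x ∈ S`, while `x ∉ S`.
    have key (a b : ℂ) (h : a • x + b • f x ∈ S) : a = 0 ∧ b = 0 := by
      have h1 := hinv _ h
      simp only [map_add, LinearMap.map_smulₛₗ, hf] at h1
      have h2 := S.sub_mem (S.smul_mem (conj a) h) (S.smul_mem b h1)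
      have h3 : conj a • (a • x + b • f x) - b • (conj a • f x + conj b • -x)
          = ((Complex.normSq a + Complex.normSq b : ℝ) : ℂ) • x := by
        rw [Complex.ofReal_add, Complex.normSq_eq_conj_mul_self, Complex.normSq_eq_conj_mul_self]
        module
      rw [h3] at h2
      have h4 : Complex.normSq a + Complex.normSq b = 0 := by
        by_contra h4
        exact hx ((S.smul_mem_iff (by exact_mod_cast h4)).1 h2)
      have ha := Complex.normSq_nonneg a
      have hb := Complex.normSq_nonneg b
      exact ⟨Complex.normSq_eq_zero.1 (by linarith), Complex.normSq_eq_zero.1 (by linarith)⟩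
    refine ⟨Fin.cons x v, ?_⟩
    rw [Fintype.linearIndependent_iff] at hv ⊢
    intro g hg
    simp only [Fintype.sum_sum_type, Sum.elim_inl, Sum.elim_inr, Fin.sum_univ_succ, Fin.cons_zero,
      Fin.cons_succ] at hg
    have h0 := key (g (Sum.inl 0)) (g (Sum.inr 0)) (by
      have : g (Sum.inl 0) • x + g (Sum.inr 0) • f x =
          -(∑ i : Fin l, g (Sum.inl i.succ) • v i + ∑ i : Fin l, g (Sum.inr i.succ) • f (v i)) := by
        rw [eq_neg_iff_add_eq_zero, ← hg]
        abel
      rw [this]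
      exact S.neg_mem (S.add_mem (S.sum_mem fun i _ => S.smul_mem _ (hSv i))
        (S.sum_mem fun i _ => S.smul_mem _ (hSf i))))
    rw [h0.1, h0.2, zero_smul, zero_smul, zero_add, zero_add] at hg
    have h1 := hv (Sum.elim (fun i => g (Sum.inl i.succ)) fun i => g (Sum.inr i.succ))
      (by simpa [Fintype.sum_sum_type] using hg)
    rintro (i | i)
    · exact Fin.cases h0.1 (fun i => h1 (Sum.inl i)) i
    · exact Fin.cases h0.2 (fun i => h1 (Sum.inr i)) i

/-! ### The action of the lift on sections. -/

namespace QuaternionicBundle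

variable {k : ℕ} {J : Type u} [TopologicalSpace J] [ChartedSpace (EuclideanSpace ℝ (Fin k)) J]
  {r : ℕ∞} {ι : J → J} {F : Type v} [NormedAddCommGroup F] [NormedSpace ℂ F]
  (E : QuaternionicBundle.{u, v, w} (k := k) r ι F)

/-- The lift of the involution to the total space. -/
def totalLift (p : E.Total) : E.Total := ⟨ι p.proj, E.lift p.proj p.2⟩

theorem totalLift_mk (x : J) (a : E.Fiber x) : E.totalLift ⟨x, a⟩ = ⟨ι x, E.lift x a⟩ := rfl

theorem totalLift_totalLift (x : J) (a : E.Fiber x) :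
    E.totalLift (E.totalLift ⟨x, a⟩) = ⟨x, -a⟩ := E.lift_lift x a

/-- The identification of two fibres over the same point. -/
def fiberCongr {x y : J} (h : x = y) : E.Fiber x ≃ₗ[ℂ] E.Fiber y := by
  subst h
  exact LinearEquiv.refl ℂ _

theorem mk_fiberCongr {x y : J} (h : x = y) (a : E.Fiber x) :
    (⟨y, E.fiberCongr h a⟩ : E.Total) = ⟨x, a⟩ := by
  subst h
  rfl

/-- The lift of the involution, as a map to the fibre over `x` from the fibre over `ι x`. -/
def liftTo (hι : Function.Involutive ι) (x : J) : E.Fiber (ι x) →ₛₗ[starRingEnd ℂ] E.Fiber x :=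
  (E.fiberCongr (hι x)).toLinearMap.comp (E.lift (ι x))

variable (hι : Function.Involutive ι)

/-- The fibres over `ι (ι x)` and `x` are only propositionally the same type. In the total space the
transport disappears, so identities between fibre vectors are checked there. -/
theorem mk_liftTo (x : J) (a : E.Fiber (ι x)) :
    (⟨x, E.liftTo hι x a⟩ : E.Total) = E.totalLift ⟨ι x, a⟩ :=
  E.mk_fiberCongr (hι x) _

theorem fiber_ext {x : J} {a b : E.Fiber x} (h : (⟨x, a⟩ : E.Total) = ⟨x, b⟩) : a = b :=
  TotalSpace.mk_inj.1 h

theorem liftTo_lift (x : J) (a : E.Fiber x) : E.liftTo hι x (E.lift x a) = -a := by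
  refine E.fiber_ext ?_
  rw [mk_liftTo, ← totalLift_mk, totalLift_totalLift]

theorem lift_liftTo (x : J) (a : E.Fiber (ι x)) : E.lift x (E.liftTo hι x a) = -a := by
  refine E.fiber_ext ?_
  rw [← totalLift_mk, mk_liftTo, totalLift_totalLift]

theorem lift_injective (hι : Function.Involutive ι) (x : J) :
    Function.Injective (E.lift x) := fun a b h => by
  have := congrArg (E.liftTo hι x) h
  rwa [liftTo_lift, liftTo_lift, neg_inj] at this

/-- The action of the lift of the involution on sections. -/
def conjSection (s : ∀ x, E.Fiber x) (x : J) : E.Fiber x := E.liftTo hι x (s (ι x))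

theorem mk_conjSection (s : ∀ x, E.Fiber x) (x : J) :
    (⟨x, E.conjSection hι s x⟩ : E.Total) = E.totalLift ⟨ι x, s (ι x)⟩ := E.mk_liftTo hι x _

theorem conjSection_apply_involution (s : ∀ x, E.Fiber x) (x : J) :
    E.conjSection hι s (ι x) = E.lift x (s x) := by
  have h : (⟨ι (ι x), s (ι (ι x))⟩ : E.Total) = ⟨x, s x⟩ := by rw [hι x]
  refine E.fiber_ext ?_
  rw [mk_conjSection, h, totalLift_mk]

theorem conjSection_conjSection (s : ∀ x, E.Fiber x) (x : J) :
    E.conjSection hι (E.conjSection hι s) x = -s x := by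
  rw [conjSection, conjSection_apply_involution, liftTo_lift]

variable {E} in
theorem contMDiff_conjSection (hs : ContMDiff (𝓡 k) (𝓡 k) ∞ ι) {s : ∀ x, E.Fiber x}
    (h : ContMDiff (𝓡 k) ((𝓡 k).prod 𝓘(ℝ, F)) r fun x => (⟨x, s x⟩ : E.Total)) :
    ContMDiff (𝓡 k) ((𝓡 k).prod 𝓘(ℝ, F)) r
      fun x => (⟨x, E.conjSection hι s x⟩ : E.Total) := by
  simp_rw [mk_conjSection]
  exact E.contMDiff_lift.comp (h.comp (hs.of_le (by exact_mod_cast le_top)))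

/-- The tuple of sections formed by a given tuple and its conjugates under the lift of the
involution. -/
def frame {l : ℕ} (s : Fin l → ∀ x, E.Fiber x) (x : J) : Fin l ⊕ Fin l → E.Fiber x :=
  Sum.elim (fun i => s i x) fun i => E.conjSection hι (s i) x

variable {E} in
theorem linearIndependent_frame_involution {l : ℕ} {s : Fin l → ∀ x, E.Fiber x} {x : J}
    (h : LinearIndependent ℂ (E.frame hι s x)) : LinearIndependent ℂ (E.frame hι s (ι x)) := by
  have := linearIndependent_sumElim_neg_conj (E.lift x) (E.lift_injective hι x) h
  convert this using 1
  ext (i | i)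
  · simp [frame, conjSection, lift_liftTo]
  · simp [frame, conjSection_apply_involution]

variable {E} in
theorem linearIndependent_frame_involution_iff {l : ℕ} {s : Fin l → ∀ x, E.Fiber x} {x : J} :
    LinearIndependent ℂ (E.frame hι s (ι x)) ↔ LinearIndependent ℂ (E.frame hι s x) := by
  refine ⟨fun h => ?_, linearIndependent_frame_involution hι⟩
  have := linearIndependent_frame_involution hι h
  rwa [hι x] at this

/-- Over a fixed point the lift is a quaternionic structure on one fibre. The frame at `x` then
depends only on the values at `x`, so the same `v` serves for every extension `s`. -/
theorem exists_linearIndependent_of_fixed [FiniteDimensional ℂ F] {l : ℕ}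
    (hl : 2 * l ≤ Module.finrank ℂ F) {x : J} (hx : ι x = x) :
    ∃ v : Fin l → E.Fiber x, ∀ s : Fin l → ∀ x, E.Fiber x, (∀ i, s i x = v i) →
      LinearIndependent ℂ (E.frame hι s x) := by
  let e := (trivializationAt F E.Fiber x).linearEquivAt ℂ x
    (FiberBundle.mem_baseSet_trivializationAt' x)
  have : FiniteDimensional ℂ (E.Fiber x) := e.symm.finiteDimensional
  let f : E.Fiber x →ₛₗ[starRingEnd ℂ] E.Fiber x :=
    (E.liftTo hι x).comp (E.fiberCongr hx.symm).toLinearMap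
  have hf (a : E.Fiber x) : (⟨x, f a⟩ : E.Total) = E.totalLift ⟨x, a⟩ := by
    rw [← E.mk_fiberCongr hx.symm a]
    exact E.mk_liftTo hι x _
  obtain ⟨v, hv⟩ := exists_linearIndependent_sumElim_conj f (fun a => E.fiber_ext <| by
    rw [hf, hf, totalLift_totalLift]) l (by rwa [e.finrank_eq])
  refine ⟨v, fun s hs => ?_⟩
  convert hv using 1
  ext (i | i)
  · exact hs i
  · simp only [frame, Sum.elim_inr]
    refine E.fiber_ext ?_
    rw [mk_conjSection, hf, ← hs i, hx]

end QuaternionicBundle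

/-! ### Local deformation of a tuple of sections. -/

namespace QuaternionicBundle

variable {k : ℕ} {J : Type u} [TopologicalSpace J] [ChartedSpace (EuclideanSpace ℝ (Fin k)) J]
  {r : ℕ∞} {ι : J → J} {F : Type v} [NormedAddCommGroup F] [NormedSpace ℂ F]
  {E : QuaternionicBundle.{u, v, w} (k := k) r ι F} (hι : Function.Involutive ι)

theorem contMDiff_frame (hs : ContMDiff (𝓡 k) (𝓡 k) ∞ ι) {l : ℕ} {s : Fin l → ∀ x, E.Fiber x}
    (h : ∀ i, ContMDiff (𝓡 k) ((𝓡 k).prod 𝓘(ℝ, F)) r fun x => (⟨x, s i x⟩ : E.Total))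
    (a : Fin l ⊕ Fin l) :
    ContMDiff (𝓡 k) ((𝓡 k).prod 𝓘(ℝ, F)) r fun x => (⟨x, E.frame hι s x a⟩ : E.Total) := by
  rcases a with i | i
  · exact h i
  · exact contMDiff_conjSection hι hs (h i)

theorem linearIndependent_trivialization_iff {κ : Type*} {c x : J}
    (hx : x ∈ (trivializationAt F E.Fiber c).baseSet) {t : κ → E.Fiber x} :
    LinearIndependent ℂ (fun a => (trivializationAt F E.Fiber c ⟨x, t a⟩).2) ↔
      LinearIndependent ℂ t :=
  LinearMap.linearIndependent_iff
    ((trivializationAt F E.Fiber c).linearEquivAt ℂ x hx).toLinearMap (LinearEquiv.ker _)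

theorem continuousOn_trivialization_sections {κ : Type*} {t : κ → ∀ x, E.Fiber x}
    (h : ∀ a, ContMDiff (𝓡 k) ((𝓡 k).prod 𝓘(ℝ, F)) r fun x => (⟨x, t a x⟩ : E.Total)) (c : J) :
    ContinuousOn (fun x a => (trivializationAt F E.Fiber c ⟨x, t a x⟩).2)
      (trivializationAt F E.Fiber c).baseSet :=
  continuousOn_pi.2 fun a =>
    (((trivializationAt F E.Fiber c).contMDiffOn_section_baseSet_iff (IB := 𝓡 k) (n := r)).1
      (h a).contMDiffOn).continuousOn

theorem isOpen_setOf_linearIndependent_sections {κ : Type*} [Finite κ] {t : κ → ∀ x, E.Fiber x}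
    (h : ∀ a, ContMDiff (𝓡 k) ((𝓡 k).prod 𝓘(ℝ, F)) r fun x => (⟨x, t a x⟩ : E.Total)) :
    IsOpen {x | LinearIndependent ℂ fun a => t a x} := by
  rw [isOpen_iff_mem_nhds]
  intro c hc
  have hb := (trivializationAt F E.Fiber c).open_baseSet.mem_nhds
    (FiberBundle.mem_baseSet_trivializationAt' c)
  have h1 := ((continuousOn_trivialization_sections h c).continuousAt hb).eventually
    (isOpen_setOfPred_linearIndependent.mem_nhds
      ((linearIndependent_trivialization_iff (mem_of_mem_nhds hb)).2 hc))
  filter_upwards [hb, h1] with x hx hx1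
  exact (linearIndependent_trivialization_iff hx).1 hx1

theorem contMDiffOn_trivialization_symm [IsManifold (𝓡 k) ∞ J] (c : J) {U : Set J} (hU : IsOpen U)
    (hUb : U ⊆ (trivializationAt F E.Fiber c).baseSet) {f : J → F}
    (hf : ContMDiffOn (𝓡 k) 𝓘(ℝ, F) r f U) :
    ContMDiffOn (𝓡 k) ((𝓡 k).prod 𝓘(ℝ, F)) r
      (fun x => (⟨x, (trivializationAt F E.Fiber c).symm x (f x)⟩ : E.Total)) U := by
  refine ((trivializationAt F E.Fiber c).contMDiffOn_section_iff hU hUb).2 (hf.congr fun x hx => ?_)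
  rw [Trivialization.apply_mk_symm _ (hUb hx)]

/-- Extension of the set where the frame of a tuple of sections is linearly independent, by a
deformation supported in a small coordinate domain. -/
theorem exists_linearIndependent_frame_of_bump [T2Space J] [IsManifold (𝓡 k) ∞ J]
    [FiniteDimensional ℂ F]
    (hs : ContMDiff (𝓡 k) (𝓡 k) ∞ ι) {l : ℕ} (hd : k + 4 * l < 2 * Module.finrank ℂ F + 2)
    {s : Fin l → ∀ x, E.Fiber x}
    (hsm : ∀ i, ContMDiff (𝓡 k) ((𝓡 k).prod 𝓘(ℝ, F)) r fun x => (⟨x, s i x⟩ : E.Total))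
    {C : Set J} (hC : IsClosed C) (hCι : ∀ x ∈ C, ι x ∈ C)
    (hli : ∀ x ∈ C, LinearIndependent ℂ (E.frame hι s x)) {c : J}
    (χ : SmoothBumpFunction (𝓡 k) c)
    (hχ : tsupport χ ⊆ (trivializationAt F E.Fiber c).baseSet)
    (hdisj : ∀ x ∈ tsupport χ, ι x ∉ tsupport χ) :
    ∃ s' : Fin l → ∀ x, E.Fiber x,
      (∀ i, ContMDiff (𝓡 k) ((𝓡 k).prod 𝓘(ℝ, F)) r fun x => (⟨x, s' i x⟩ : E.Total)) ∧
      (∀ x, x ∈ C ∨ χ x = 1 ∨ χ (ι x) = 1 → LinearIndependent ℂ (E.frame hι s' x)) ∧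
      ∀ x, x ∉ tsupport χ → ι x ∉ tsupport χ → ∀ i, s' i x = s i x := by
  set e := trivializationAt F E.Fiber c with he
  have hfr := contMDiff_frame hι hs hsm
  obtain ⟨P, hP, hPli⟩ := exists_contMDiffOn_linearIndependent_add_smul
    (κ := Fin l ⊕ Fin l) (W := F) (by simp; omega) χ
    (M := fun x a => (e ⟨x, E.frame hι s x a⟩).2)
    ((continuousOn_trivialization_sections hfr c).mono hχ) hC
    (fun x hx => (linearIndependent_trivialization_iff (hχ hx.2)).2 (hli x hx.1))
  let d (a : Fin l ⊕ Fin l) : ∀ x, E.Fiber x :=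
    (χ : J → ℝ) • ((fun x => e.symm x (P x a)) - fun x => E.frame hι s x a)
  have hd0 (a) (x) (hx : x ∉ tsupport χ) : d a x = 0 := by
    simp [d, image_eq_zero_of_notMem_tsupport hx]
  have hdsm (a) : ContMDiff (𝓡 k) ((𝓡 k).prod 𝓘(ℝ, F)) r fun x => (⟨x, d a x⟩ : E.Total) := by
    have hU : IsOpen (e.baseSet ∩ (chartAt (EuclideanSpace ℝ (Fin k)) c).source) :=
      e.open_baseSet.inter (chartAt _ c).open_source
    refine ContMDiffOn.smul_section_of_tsupport
      ((χ.contMDiff.of_le (by exact_mod_cast le_top)).contMDiffOn) hU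
      (Set.subset_inter hχ χ.tsupport_subset_chartAt_source) ?_
    refine ContMDiffOn.sub_section ?_ (hfr a).contMDiffOn
    refine contMDiffOn_trivialization_symm c hU Set.inter_subset_left ?_
    exact (contMDiffOn_pi_space.1 hP a).of_le (by exact_mod_cast le_top) |>.mono
      Set.inter_subset_right
  let s' (i : Fin l) : ∀ x, E.Fiber x :=
    -- Conjugation of sections squares to `-1`, so the minus sign makes `d (Sum.inr i)` appear with
    -- a plus sign in the conjugate of `s' i`. On `tsupport χ` the conjugated corrections vanish by
    -- `hdisj`, and both halves of the frame change by the prescribed `d`.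
    s i + d (Sum.inl i) - E.conjSection hι (d (Sum.inr i))
  have hs'conj (i x) : E.conjSection hι (s' i) x =
      E.conjSection hι (s i) x + E.conjSection hι (d (Sum.inl i)) x + d (Sum.inr i) x := by
    have : E.conjSection hι (s' i) x = E.conjSection hι (s i) x +
        E.conjSection hι (d (Sum.inl i)) x
        - E.conjSection hι (E.conjSection hι (d (Sum.inr i))) x := by
      simp [s', conjSection]
    rw [this, conjSection_conjSection, sub_neg_eq_add]
  have hconj0 (a x) (hx : ι x ∉ tsupport χ) : E.conjSection hι (d a) x = 0 := by
    simp [conjSection, hd0 a _ hx]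
  have hout (x) (hx : x ∉ tsupport χ) (hx' : ι x ∉ tsupport χ) (i) : s' i x = s i x := by
    simp [s', hd0 _ x hx, hconj0 _ x hx']
  have hin (x) (hx : x ∈ tsupport χ) (h : x ∈ C ∨ χ x = 1) :
      LinearIndependent ℂ (E.frame hι s' x) := by
    have hfr' (a) : E.frame hι s' x a = E.frame hι s x a + d a x := by
      rcases a with i | i
      · simp [frame, s', hconj0 _ x (hdisj x hx)]
      · simp only [frame, Sum.elim_inr]
        rw [hs'conj, hconj0 _ x (hdisj x hx), add_zero]
    refine (linearIndependent_trivialization_iff (hχ hx)).1 ?_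
    convert hPli x hx h using 1
    ext a
    have hlin (b : E.Fiber x) : (e ⟨x, b⟩).2 = e.linearEquivAt ℂ x (hχ hx) b := rfl
    have hsymm : e.symm x (P x a) = (e.linearEquivAt ℂ x (hχ hx)).symm (P x a) := rfl
    simp only [← he, hfr', hlin, map_add, d, Pi.smul_apply', Pi.sub_apply, Pi.add_apply,
      Pi.smul_apply]
    rw [hsymm, ← Complex.coe_smul, map_smul, map_sub, LinearEquiv.apply_symm_apply,
      Complex.coe_smul]
  refine ⟨s', fun i => ?_, fun x hx => ?_, hout⟩
  · exact ((hsm i).add_section (hdsm _)).sub_section (contMDiff_conjSection hι hs (hdsm _))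
  · have h1 (y) (hy : χ y = 1) : y ∈ tsupport χ := subset_tsupport _ (by simp [hy])
    by_cases hxs : x ∈ tsupport χ
    · refine hin x hxs ?_
      rcases hx with hx | hx | hx
      · exact Or.inl hx
      · exact Or.inr hx
      · exact absurd (h1 _ hx) (hdisj x hxs)
    -- On the mirror image of the support, independence is inherited from the point `ι x`; outside
    -- both sets the frame is unchanged.
    by_cases hxs' : ι x ∈ tsupport χ
    · rw [← linearIndependent_frame_involution_iff hι]
      refine hin _ hxs' ?_
      rcases hx with hx | hx | hx
      · exact Or.inl (hCι x hx)
      · exact absurd (h1 _ hx) hxs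
      · exact Or.inr hx
    · rcases hx with hx | hx | hx
      · convert hli x hx using 1
        ext (i | i)
        · exact hout x hxs hxs' i
        · simp only [frame, Sum.elim_inr]
          rw [hs'conj, hd0 _ x hxs, hconj0 _ x hxs', add_zero, add_zero]
      · exact absurd (h1 _ hx) hxs
      · exact absurd (h1 _ hx) hxs'

end QuaternionicBundle

/-! ### Existence of a global independent frame. -/

namespace QuaternionicBundle

variable {k : ℕ} {J : Type u} [TopologicalSpace J] [ChartedSpace (EuclideanSpace ℝ (Fin k)) J]
  {r : ℕ∞} {ι : J → J} {F : Type v} [NormedAddCommGroup F] [NormedSpace ℂ F]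
  {E : QuaternionicBundle.{u, v, w} (k := k) r ι F} (hι : Function.Involutive ι)

/-- A section of class `C^r` with prescribed values on a discrete closed set. -/
theorem exists_section_eqOn_of_discrete [T2Space J] [SigmaCompactSpace J] [IsManifold (𝓡 k) ∞ J]
    {S : Set J} (hS : IsClosed S) (hd : DiscreteTopology S) (v : ∀ x, E.Fiber x) :
    ∃ s : ∀ x, E.Fiber x,
      ContMDiff (𝓡 k) ((𝓡 k).prod 𝓘(ℝ, F)) r (fun x => (⟨x, s x⟩ : E.Total)) ∧
      ∀ x ∈ S, s x = v x := by
  -- The condition on each fibre is a single point or everything, hence convex, so local solutions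
  -- glue. Near a point of `S` a neighbourhood containing no other point of `S` admits a solution
  -- that is constant in the trivialization.
  obtain ⟨s, hs⟩ := exists_contMDiffSection_forall_mem_convex_of_local (n := r) (𝓡 k)
    (F_fiber := F) E.Fiber (fun x => {a | x ∈ S → a = v x})
    (fun x => (convex_singleton _).setOfPred_const_imp) (fun x => by
      by_cases hx : x ∈ S
      · set e := trivializationAt F E.Fiber x
        have hxe : x ∈ e.baseSet := FiberBundle.mem_baseSet_trivializationAt' x
        obtain ⟨U, hU, hxU⟩ := (discreteTopology_subtype_iff'.1 hd) x hx
        refine ⟨e.baseSet ∩ U, Filter.inter_mem (e.open_baseSet.mem_nhds hxe)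
          (hU.mem_nhds (hxU.symm.subset rfl).1), fun y => e.symm y (e ⟨x, v x⟩).2, ?_, ?_⟩
        · exact contMDiffOn_trivialization_symm x (e.open_baseSet.inter hU) Set.inter_subset_left
            contMDiffOn_const
        · intro y hy hyS
          obtain rfl : y = x := hxU.subset ⟨hy.2, hyS⟩
          exact (e.linearEquivAt ℂ y hxe).symm_apply_apply (v y)
      · exact ⟨Sᶜ, hS.isOpen_compl.mem_nhds hx, fun y => 0,
          (contMDiff_zeroSection ℝ E.Fiber).contMDiffOn, fun y hy hyS => absurd hyS hy⟩)
  exact ⟨s, s.contMDiff, hs⟩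

/-- General position: a quaternionic bundle over a manifold of small dimension with an involution
with isolated fixed points has a tuple of sections which, together with their conjugates under the
lift of the involution, are everywhere linearly independent. -/
theorem exists_linearIndependent_frame [T2Space J] [SecondCountableTopology J]
    [IsManifold (𝓡 k) ∞ J] [FiniteDimensional ℂ F]
    (hs : ContMDiff (𝓡 k) (𝓡 k) ∞ ι) (hfix : DiscreteTopology (Function.fixedPoints ι)) {l : ℕ}
    (hl : 2 * l ≤ Module.finrank ℂ F) (hd : k + 4 * l < 2 * Module.finrank ℂ F + 2) :
    ∃ s : Fin l → ∀ x, E.Fiber x,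
      (∀ i, ContMDiff (𝓡 k) ((𝓡 k).prod 𝓘(ℝ, F)) r fun x => (⟨x, s i x⟩ : E.Total)) ∧
      ∀ x, LinearIndependent ℂ (E.frame hι s x) := by
  classical
  have := ChartedSpace.locallyCompactSpace (EuclideanSpace ℝ (Fin k)) J
  have hιc : Continuous ι := hs.continuous
  have hFc : IsClosed (Function.fixedPoints ι) := isClosed_fixedPoints hιc
  -- sections with independent frames over the fixed points
  have hv : ∀ x, ∃ v : Fin l → E.Fiber x, x ∈ Function.fixedPoints ι →
      ∀ s : Fin l → ∀ x, E.Fiber x, (∀ i, s i x = v i) → LinearIndependent ℂ (E.frame hι s x) := by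
    intro x
    by_cases hx : x ∈ Function.fixedPoints ι
    · obtain ⟨v, hv⟩ := E.exists_linearIndependent_of_fixed hι hl hx
      exact ⟨v, fun _ => hv⟩
    · exact ⟨0, fun h => absurd h hx⟩
  choose v hv using hv
  choose s₀ hs₀ hs₀v using fun i => exists_section_eqOn_of_discrete (E := E) hFc hfix fun x => v x i
  have hN := isOpen_setOf_linearIndependent_sections (contMDiff_frame hι hs hs₀)
  obtain ⟨V, hV, hFV, hVN⟩ := normal_exists_closure_subset hFc hN
    fun x hx => hv x hx s₀ fun i => hs₀v i x hx
  -- Symmetrizing the good neighbourhood of the fixed points costs nothing, since independence at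
  -- `x` and at `ι x` are equivalent.
  set C₀ := closure V ∪ ι ⁻¹' closure V with hC₀
  have hC₀c : IsClosed C₀ := isClosed_closure.union (isClosed_closure.preimage hιc)
  have hC₀ι : ∀ x ∈ C₀, ι x ∈ C₀ := by
    rintro x (hx | hx)
    · exact Or.inr (by rwa [Set.mem_preimage, hι x])
    · exact Or.inl hx
  have hC₀li : ∀ x ∈ C₀, LinearIndependent ℂ (E.frame hι s₀ x) := by
    rintro x (hx | hx)
    · exact hVN hx
    · exact (linearIndependent_frame_involution_iff hι).1 (hVN hx)
  -- a covering of the rest of the manifold by small coordinate domains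
  have hU (x : J) (hx : x ∈ Vᶜ) : ∃ U ∈ 𝓝 x, U ⊆ (trivializationAt F E.Fiber x).baseSet ∧
      ∀ y ∈ U, ι y ∉ U := by
    have hne : x ≠ ι x := fun h => hx (hFV h.symm)
    obtain ⟨A, B, hA, hB, hxA, hxB, hAB⟩ := t2_separation hne
    refine ⟨A ∩ ι ⁻¹' B ∩ (trivializationAt F E.Fiber x).baseSet, ?_, Set.inter_subset_right, ?_⟩
    · exact Filter.inter_mem (Filter.inter_mem (hA.mem_nhds hxA)
        ((hB.preimage hιc).mem_nhds hxB))
        ((trivializationAt F E.Fiber x).open_baseSet.mem_nhds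
          (FiberBundle.mem_baseSet_trivializationAt' x))
    · exact fun y hy hy' => hAB.le_bot ⟨hy'.1.1, hy.1.2⟩
  choose! U hUn hUb hUd using hU
  obtain ⟨I, χ, hχ⟩ := SmoothBumpCovering.exists_isSubordinate (𝓡 k) hV.isClosed_compl hUn
  have hlf : LocallyFinite fun i => tsupport (χ i) := χ.locallyFinite.closure
  have hI : Countable I := by
    rw [← Set.countable_univ_iff]
    exact χ.locallyFinite.countable_univ fun i => (χ i).nonempty_support
  obtain ⟨enc, henc⟩ := hI.exists_injective_nat
  -- iterated deformation
  let K (i : I) : Set J := {x | χ i x = 1 ∨ χ i (ι x) = 1}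
  -- The set secured before stage `n`. It is closed and invariant, as the deformation lemma
  -- requires; stage `n` adds the `K i` with `enc i = n`, if there is such an `i`.
  let C (n : ℕ) : Set J := C₀ ∪ ⋃ i ∈ {i | enc i < n}, K i
  have hCc (n) : IsClosed (C n) := by
    refine hC₀c.union (((Set.finite_lt_nat n).preimage henc.injOn).isClosed_biUnion fun i _ => ?_)
    exact (isClosed_singleton.preimage (χ i).continuous).union
      (isClosed_singleton.preimage ((χ i).continuous.comp hιc))
  have hCι (n) : ∀ x ∈ C n, ι x ∈ C n := by
    rintro x (hx | hx)
    · exact Or.inl (hC₀ι x hx)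
    · right
      simp only [Set.mem_iUnion] at hx ⊢
      obtain ⟨i, hi, hx⟩ := hx
      refine ⟨i, hi, ?_⟩
      rcases hx with hx | hx
      · exact Or.inr (by rwa [hι x])
      · exact Or.inl hx
  let Good (n : ℕ) (s : Fin l → ∀ x, E.Fiber x) : Prop :=
    (∀ i, ContMDiff (𝓡 k) ((𝓡 k).prod 𝓘(ℝ, F)) r fun x => (⟨x, s i x⟩ : E.Total)) ∧
      ∀ x ∈ C n, LinearIndependent ℂ (E.frame hι s x)
  have hstep (n : ℕ) (s) (h : Good n s) : ∃ s', Good (n + 1) s' ∧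
      ∀ x, (∀ i, enc i = n → x ∉ tsupport (χ i) ∧ ι x ∉ tsupport (χ i)) → ∀ j, s' j x = s j x := by
    by_cases hn : ∃ i, enc i = n
    · obtain ⟨i, rfl⟩ := hn
      obtain ⟨s', h1, h2, h3⟩ := exists_linearIndependent_frame_of_bump hι hs hd h.1 (hCc _)
        (hCι _) h.2 (χ i) ((hχ i).trans (hUb _ (χ.c_mem' i)))
        fun x hx hx' => hUd _ (χ.c_mem' i) x (hχ i hx) (hχ i hx')
      refine ⟨s', ⟨h1, fun x hx => h2 x ?_⟩, fun x hx => h3 x (hx i rfl).1 (hx i rfl).2⟩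
      rcases hx with hx | hx
      · exact Or.inl (Or.inl hx)
      · simp only [Set.mem_iUnion] at hx
        obtain ⟨i', hi', hx⟩ := hx
        rcases (Nat.lt_succ_iff.1 hi').lt_or_eq with h' | h'
        · exact Or.inl (Or.inr (Set.mem_biUnion h' hx))
        · obtain rfl := henc h'
          exact Or.inr hx
    · refine ⟨s, ⟨h.1, fun x hx => h.2 x ?_⟩, fun _ _ _ => rfl⟩
      rcases hx with hx | hx
      · exact Or.inl hx
      · simp only [Set.mem_iUnion] at hx
        obtain ⟨i', hi', hx⟩ := hx
        refine Or.inr (Set.mem_biUnion ?_ hx)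
        exact lt_of_le_of_ne (Nat.lt_succ_iff.1 hi') fun h' => hn ⟨i', h'⟩
  choose! g hg hgeq using hstep
  let f (n : ℕ) : Fin l → ∀ x, E.Fiber x := Nat.rec s₀ (fun n s => g n s) n
  have hf (n) : Good n (f n) := by
    induction n with
    | zero => exact ⟨hs₀, fun x hx => hC₀li x (by simpa [C] using hx)⟩
    | succ n ih => exact hg n _ ih
  have hfin : LocallyFinite fun n => {x | (fun j => f (n + 1) j x) ≠ fun j => f n j x} := by
    intro x
    obtain ⟨A, hA, hAf⟩ := hlf x
    obtain ⟨B, hB, hBf⟩ := hlf.preimage_continuous hιc x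
    refine ⟨A ∩ B, Filter.inter_mem hA hB, ((hAf.union hBf).image enc).subset ?_⟩
    rintro n ⟨y, hy, hyA, hyB⟩
    by_contra hcon
    refine hy (funext fun j => hgeq n _ (hf n) y (fun i hi => ⟨fun h => ?_, fun h => ?_⟩) j)
    · exact hcon ⟨i, Or.inl ⟨y, h, hyA⟩, hi⟩
    · exact hcon ⟨i, Or.inr ⟨y, h, hyB⟩, hi⟩
  -- Only finitely many stages alter the sections near a given point, so the sequence is eventually
  -- constant on a neighbourhood, and the limit inherits the class `C^r`.
  obtain ⟨S, hS⟩ := hfin.exists_forall_eventually_atTop_eventually_eq'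
    (f := fun n x j => f n j x)
  refine ⟨fun j x => S x j, fun j x => ?_, fun x => ?_⟩
  · obtain ⟨n, hn⟩ := (hS x).exists
    refine ((hf n).1 j x).congr_of_eventuallyEq ?_
    filter_upwards [hn] with y hy
    rw [← hy]
  · have hx : ∃ n, x ∈ C n := by
      by_cases hxV : x ∈ V
      · exact ⟨0, Or.inl (Or.inl (subset_closure hxV))⟩
      · obtain ⟨i, hi⟩ := χ.eventuallyEq_one' x hxV
        exact ⟨enc i + 1,
          Or.inr (Set.mem_biUnion (Nat.lt_succ_self (enc i)) (Or.inl hi.self_of_nhds))⟩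
    obtain ⟨N, hN⟩ := hx
    -- The frame at `x` also reads the sections at `ι x`, so the stage must be stable near both
    -- points.
    obtain ⟨n, hnx, hnx', hn⟩ :=
      ((hS x).and ((hS (ι x)).and (Filter.eventually_ge_atTop N))).exists
    have hxn : x ∈ C n := by
      refine hN.imp_right fun h => ?_
      simp only [Set.mem_iUnion] at h ⊢
      obtain ⟨i, hi, h⟩ := h
      exact ⟨i, lt_of_lt_of_le hi hn, h⟩
    convert (hf n).2 x hxn using 1
    ext (j | j)
    · exact (congrFun hnx.self_of_nhds j).symm
    · simp only [frame, Sum.elim_inr, conjSection]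
      exact congrArg _ (congrFun hnx'.self_of_nhds j).symm

end QuaternionicBundle

/-! ### Calculus of families of complex linear maps. -/

section

variable {H EM M : Type*} [NormedAddCommGroup EM] [NormedSpace ℝ EM] [TopologicalSpace H]
  {IM : ModelWithCorners ℝ EM H} [TopologicalSpace M] [ChartedSpace H M] {n : ℕ∞ω}
  {V G : Type*} [NormedAddCommGroup V] [NormedSpace ℂ V] [NormedAddCommGroup G] [NormedSpace ℂ G]

/-- In finite dimensions an operator is a fixed real linear expression in its values on a basis. -/
theorem ContMDiffWithinAt.complexClm_of_apply [FiniteDimensional ℂ V] {f : M → V →L[ℂ] G}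
    {s : Set M} {x : M} (h : ∀ v, ContMDiffWithinAt IM 𝓘(ℝ, G) n (fun y => f y v) s x) :
    ContMDiffWithinAt IM 𝓘(ℝ, V →L[ℂ] G) n f s x := by
  let b := Module.finBasis ℂ V
  let c (i) : V →L[ℂ] ℂ := LinearMap.toContinuousLinearMap (b.coord i)
  have hf : f = fun y => ∑ i, (ContinuousLinearMap.smulRightL ℂ V G (c i)).restrictScalars ℝ
      (f y (b i)) := by
    ext y v
    conv_lhs => rw [← b.sum_repr v, map_sum]
    simp [c]
  rw [hf]
  refine contMDiffWithinAt_finsetSum fun i _ => ?_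
  exact (ContinuousLinearMap.contMDiff _).contMDiffAt.comp_contMDiffWithinAt x (h (b i))

theorem ContMDiffWithinAt.complexClm_apply {f : M → V →L[ℂ] G} {g : M → V} {s : Set M} {x : M}
    (hf : ContMDiffWithinAt IM 𝓘(ℝ, V →L[ℂ] G) n f s x)
    (hg : ContMDiffWithinAt IM 𝓘(ℝ, V) n g s x) :
    ContMDiffWithinAt IM 𝓘(ℝ, G) n (fun y => f y (g y)) s x :=
  ContMDiffWithinAt.clm_apply (g := fun y => (f y).restrictScalars ℝ)
    ((ContinuousLinearMap.restrictScalarsL ℂ V G ℝ ℝ).contMDiff.contMDiffAt.comp_contMDiffWithinAt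
      x hf) hg

theorem ContMDiffWithinAt.ringInverse [FiniteDimensional ℂ V] {f : M → V →L[ℂ] V} {s : Set M}
    {x : M} (hf : ContMDiffWithinAt IM 𝓘(ℝ, V →L[ℂ] V) n f s x) (hx : IsUnit (f x)) :
    ContMDiffWithinAt IM 𝓘(ℝ, V →L[ℂ] V) n (fun y => Ring.inverse (f y)) s x := by
  have : CompleteSpace V := FiniteDimensional.complete ℂ V
  obtain ⟨u, hu⟩ := hx
  have h := contDiffAt_ringInverse (n := n) ℝ u
  rw [hu] at h
  exact h.contMDiffAt.comp_contMDiffWithinAt x hf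

end

/-! ### Fibrewise retractions onto the span of a frame. -/

namespace QuaternionicBundle

variable {k : ℕ} {J : Type u} [TopologicalSpace J] [ChartedSpace (EuclideanSpace ℝ (Fin k)) J]
  {r : ℕ∞} {ι : J → J} {F : Type v} [NormedAddCommGroup F] [NormedSpace ℂ F]
  {E : QuaternionicBundle.{u, v, w} (k := k) r ι F}
  {H EM M : Type*} [NormedAddCommGroup EM] [NormedSpace ℝ EM] [TopologicalSpace H]
  {IM : ModelWithCorners ℝ EM H} [TopologicalSpace M] [ChartedSpace H M]

/-- The base point varies with a parameter in an arbitrary `M`, because the maps needed later are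
defined on total spaces and on `J × ℍˡ`, not only on `J`. -/
theorem contMDiff_total_add {b : M → J} {f g : ∀ p, E.Fiber (b p)}
    (hf : ContMDiff IM ((𝓡 k).prod 𝓘(ℝ, F)) r fun p => (⟨b p, f p⟩ : E.Total))
    (hg : ContMDiff IM ((𝓡 k).prod 𝓘(ℝ, F)) r fun p => (⟨b p, g p⟩ : E.Total)) :
    ContMDiff IM ((𝓡 k).prod 𝓘(ℝ, F)) r fun p => (⟨b p, f p + g p⟩ : E.Total) := by
  intro p
  have hf' := contMDiffAt_totalSpace.1 (hf p)
  have hg' := contMDiffAt_totalSpace.1 (hg p)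
  refine contMDiffAt_totalSpace.2 ⟨hf'.1, (hf'.2.add hg'.2).congr_of_eventuallyEq ?_⟩
  filter_upwards [hf'.1.continuousAt ((trivializationAt F E.Fiber (b p)).open_baseSet.mem_nhds
    (FiberBundle.mem_baseSet_trivializationAt' (b p)))] with q hq
  exact ((trivializationAt F E.Fiber (b p)).linear ℂ hq).map_add _ _

theorem contMDiff_total_smul {b : M → J} {c : M → ℂ} {f : ∀ p, E.Fiber (b p)}
    (hc : ContMDiff IM 𝓘(ℝ, ℂ) r c)
    (hf : ContMDiff IM ((𝓡 k).prod 𝓘(ℝ, F)) r fun p => (⟨b p, f p⟩ : E.Total)) :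
    ContMDiff IM ((𝓡 k).prod 𝓘(ℝ, F)) r fun p => (⟨b p, c p • f p⟩ : E.Total) := by
  intro p
  have hf' := contMDiffAt_totalSpace.1 (hf p)
  refine contMDiffAt_totalSpace.2 ⟨hf'.1, ?_⟩
  have hsm : ContDiff ℝ r fun q : ℂ × F => q.1 • q.2 := contDiff_fst.smul contDiff_snd
  refine (hsm.contMDiff.contMDiffAt.comp p ((hc p).prodMk_space hf'.2)).congr_of_eventuallyEq ?_
  filter_upwards [hf'.1.continuousAt ((trivializationAt F E.Fiber (b p)).open_baseSet.mem_nhds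
    (FiberBundle.mem_baseSet_trivializationAt' (b p)))] with q hq
  exact ((trivializationAt F E.Fiber (b p)).linear ℂ hq).map_smul _ _

theorem contMDiff_total_sum {b : M → J} (hb : ContMDiff IM (𝓡 k) r b) {κ : Type*} (S : Finset κ)
    {f : κ → ∀ p, E.Fiber (b p)}
    (hf : ∀ a, ContMDiff IM ((𝓡 k).prod 𝓘(ℝ, F)) r fun p => (⟨b p, f a p⟩ : E.Total)) :
    ContMDiff IM ((𝓡 k).prod 𝓘(ℝ, F)) r fun p => (⟨b p, ∑ a ∈ S, f a p⟩ : E.Total) := by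
  classical
  induction S using Finset.induction_on with
  | empty => exact (contMDiff_zeroSection ℝ E.Fiber).comp hb
  | insert a S ha ih =>
    simp only [Finset.sum_insert ha]
    exact contMDiff_total_add (hf a) ih

theorem contMDiff_trivialization_snd (c : J) :
    ContMDiffOn ((𝓡 k).prod 𝓘(ℝ, F)) 𝓘(ℝ, F) r
      (fun p : E.Total => (trivializationAt F E.Fiber c p).2)
      (TotalSpace.proj ⁻¹' (trivializationAt F E.Fiber c).baseSet) := by
  have h := ((trivializationAt F E.Fiber c).contMDiffOn_iff (n := r) (IB := 𝓡 k)
    (IM := (𝓡 k).prod 𝓘(ℝ, F)) (f := id) (s := (trivializationAt F E.Fiber c).source)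
    (Set.mapsTo_id _)).1 contMDiffOn_id
  rw [← Trivialization.source_eq]
  exact h.2

/-- Local version of `exists_fiberwise_retraction`. -/
theorem exists_local_fiberwise_retraction [FiniteDimensional ℂ F] {κ : Type*} [Fintype κ]
    [DecidableEq κ] {t : κ → ∀ x, E.Fiber x}
    (ht : ∀ a, ContMDiff (𝓡 k) ((𝓡 k).prod 𝓘(ℝ, F)) r fun x => (⟨x, t a x⟩ : E.Total))
    (hli : ∀ x, LinearIndependent ℂ fun a => t a x) (c : J) :
    ∃ U : Set J, IsOpen U ∧ c ∈ U ∧ ∃ ρ : ∀ x, E.Fiber x →ₗ[ℂ] (κ → ℂ),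
      ContMDiffOn ((𝓡 k).prod 𝓘(ℝ, F)) 𝓘(ℝ, κ → ℂ) r (fun p : E.Total => ρ p.proj p.2)
        (TotalSpace.proj ⁻¹' U) ∧
      ∀ x ∈ U, ∀ a, ρ x (t a x) = Pi.single a 1 := by
  set e := trivializationAt F E.Fiber c with he
  have hce : c ∈ e.baseSet := FiberBundle.mem_baseSet_trivializationAt' c
  let y (a : κ) (x : J) : F := (e ⟨x, t a x⟩).2
  have hy (a) : ContMDiffOn (𝓡 k) 𝓘(ℝ, F) r (y a) e.baseSet :=
    (e.contMDiffOn_section_baseSet_iff).1 (ht a).contMDiffOn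
  have hyc : LinearIndependent ℂ fun a => y a c :=
    (linearIndependent_trivialization_iff hce).2 (hli c)
  obtain ⟨R₀, hR₀⟩ := LinearMap.exists_leftInverse_of_injective
    (Fintype.linearCombination ℂ fun a => y a c)
    (LinearMap.ker_eq_bot.2 hyc.fintypeLinearCombination_injective)
  let R : F →L[ℂ] (κ → ℂ) := LinearMap.toContinuousLinearMap R₀
  have hR (a) : R (y a c) = Pi.single a 1 := by
    have := LinearMap.congr_fun hR₀ (Pi.single a 1)
    rwa [LinearMap.comp_apply, Fintype.linearCombination_apply_single, one_smul] at this
  -- `R` inverts the frame at `c` only. At nearby points the error is `N x`, with `N c = 1`, so `N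
  -- x` is invertible near `c` and `(N x)⁻¹ ∘ R` inverts the frame at `x`.
  let N (x : J) : (κ → ℂ) →L[ℂ] (κ → ℂ) := LinearMap.toContinuousLinearMap
    (Fintype.linearCombination ℂ fun a => R (y a x))
  have hNsingle (x a) : N x (Pi.single a 1) = R (y a x) := by
    simp [N, Fintype.linearCombination_apply_single]
  have hN : ContMDiffOn (𝓡 k) 𝓘(ℝ, (κ → ℂ) →L[ℂ] (κ → ℂ)) r N e.baseSet := by
    intro x hx
    refine ContMDiffWithinAt.complexClm_of_apply fun v => ?_
    simp only [N, LinearMap.coe_toContinuousLinearMap', Fintype.linearCombination_apply]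
    refine contMDiffWithinAt_finsetSum fun a _ => ?_
    refine ((((v a • R).restrictScalars ℝ).contMDiff).contMDiffAt.comp_contMDiffWithinAt x
      (hy a x hx)).congr (fun z _ => rfl) rfl
  have hNc : N c = 1 := by
    refine ContinuousLinearMap.coe_injective ((Pi.basisFun ℂ κ).ext fun a => ?_)
    simp only [Pi.basisFun_apply]
    exact (hNsingle c a).trans (hR a)
  have : CompleteSpace (κ → ℂ) := inferInstance
  have hopen : IsOpen (e.baseSet ∩ N ⁻¹' {f | IsUnit f}) :=
    hN.continuousOn.isOpen_inter_preimage e.open_baseSet Units.isOpen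
  refine ⟨_, hopen, ⟨hce, by rw [Set.mem_preimage, hNc]; exact isUnit_one⟩,
    fun x => (Ring.inverse (N x)).toLinearMap ∘ₗ R.toLinearMap ∘ₗ e.linearMapAt ℂ x, ?_, ?_⟩
  · intro p hp
    have h1 : ContMDiffWithinAt ((𝓡 k).prod 𝓘(ℝ, F)) 𝓘(ℝ, (κ → ℂ) →L[ℂ] (κ → ℂ)) r
        (fun p : E.Total => Ring.inverse (N p.proj))
        (TotalSpace.proj ⁻¹' (e.baseSet ∩ N ⁻¹' {f | IsUnit f})) p := by
      refine ContMDiffWithinAt.ringInverse (f := fun p : E.Total => N p.proj) ?_ hp.2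
      exact (hN _ hp.1).comp p (contMDiff_proj E.Fiber).contMDiffAt.contMDiffWithinAt
        fun q hq => hq.1
    have h2 := ((contMDiff_trivialization_snd (E := E) c) p hp.1).mono
      (Set.preimage_mono (f := TotalSpace.proj) (s := e.baseSet ∩ N ⁻¹' {f | IsUnit f})
        Set.inter_subset_left)
    refine (h1.complexClm_apply ((R.restrictScalars ℝ).contMDiff.contMDiffAt.comp_contMDiffWithinAt
      p h2)).congr (fun q hq => ?_) ?_
    · simp only [LinearMap.comp_apply, Trivialization.linearMapAt_apply, if_pos hq.1]
      rfl
    · simp only [LinearMap.comp_apply, Trivialization.linearMapAt_apply, if_pos hp.1]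
      rfl
  · intro x hx a
    simp only [LinearMap.comp_apply, Trivialization.linearMapAt_apply, if_pos hx.1]
    have h1 : R (e ⟨x, t a x⟩).2 = N x (Pi.single a 1) := (hNsingle x a).symm
    have h2 : Ring.inverse (N x) * N x = 1 := Ring.inverse_mul_cancel _ hx.2
    change Ring.inverse (N x) (R (e ⟨x, t a x⟩).2) = _
    rw [h1]
    exact DFunLike.congr_fun h2 _

/-- A linearly independent tuple of sections of class `C^r` has a fiberwise linear retraction of
class `C^r`. -/
theorem exists_fiberwise_retraction [T2Space J] [SigmaCompactSpace J] [IsManifold (𝓡 k) ∞ J]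
    [FiniteDimensional ℂ F] {κ : Type*} [Fintype κ] [DecidableEq κ] {t : κ → ∀ x, E.Fiber x}
    (ht : ∀ a, ContMDiff (𝓡 k) ((𝓡 k).prod 𝓘(ℝ, F)) r fun x => (⟨x, t a x⟩ : E.Total))
    (hli : ∀ x, LinearIndependent ℂ fun a => t a x) :
    ∃ ρ : ∀ x, E.Fiber x →ₗ[ℂ] (κ → ℂ),
      ContMDiff ((𝓡 k).prod 𝓘(ℝ, F)) 𝓘(ℝ, κ → ℂ) r (fun p : E.Total => ρ p.proj p.2) ∧
      ∀ x a, ρ x (t a x) = Pi.single a 1 := by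
  choose U hU hcU ρ hρ hρt using exists_local_fiberwise_retraction ht hli
  -- Left inverses of a given linear map form an affine space, so weighted averages of the local
  -- retractions are again retractions.
  obtain ⟨χ, hχ⟩ := SmoothPartitionOfUnity.exists_isSubordinate (𝓡 k) isClosed_univ U hU
    fun x _ => Set.mem_iUnion.2 ⟨x, hcU x⟩
  have hfin (x : J) : (Function.support fun i => χ i x).Finite := χ.locallyFinite.point_finite x
  have hfin' (x : J) : (Function.support fun i => χ i x • ρ i x).Finite :=
    (hfin x).subset fun i hi h0 => hi (by simp [h0])
  have happ (x : J) (v : E.Fiber x) :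
      (∑ᶠ i, χ i x • ρ i x : E.Fiber x →ₗ[ℂ] (κ → ℂ)) v = ∑ᶠ i, χ i x • ρ i x v := by
    exact map_finsum (LinearMap.applyₗ (R := ℂ) (M₂ := κ → ℂ) v) (hfin' x)
  refine ⟨fun x => ∑ᶠ i, χ i x • ρ i x, ?_, fun x a => ?_⟩
  · simp_rw [happ]
    refine contMDiff_finsum (fun i => ?_) ?_
    · refine contMDiff_of_contMDiffOn_union_of_isOpen
        (s := TotalSpace.proj ⁻¹' U i) (t := TotalSpace.proj ⁻¹' (tsupport (χ i))ᶜ) ?_ ?_ ?_ ?_ ?_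
      · have h1 : ContMDiff ((𝓡 k).prod 𝓘(ℝ, F)) 𝓘(ℝ, ℝ) r fun p : E.Total => χ i p.proj :=
          ((χ i).contMDiff.of_le (by exact_mod_cast le_top)).comp (contMDiff_proj E.Fiber)
        exact h1.contMDiffOn.smul (hρ i)
      · refine (contMDiffOn_const (c := (0 : κ → ℂ))).congr fun p hp => ?_
        rw [image_eq_zero_of_notMem_tsupport hp, zero_smul]
      · rw [← Set.preimage_union]
        refine Set.preimage_eq_univ_iff.2 fun x _ => ?_
        by_cases hx : x ∈ tsupport (χ i)
        · exact Or.inl (hχ i hx)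
        · exact Or.inr hx
      · exact (hU i).preimage (FiberBundle.continuous_proj F E.Fiber)
      · exact (isClosed_tsupport _).isOpen_compl.preimage (FiberBundle.continuous_proj F E.Fiber)
    · refine (χ.locallyFinite.preimage_continuous (FiberBundle.continuous_proj F E.Fiber)).subset
        fun i p hp h0 => hp ?_
      change χ i p.proj • _ = _
      rw [show χ i p.proj = 0 from h0, zero_smul]
  · rw [happ]
    have h1 (i : J) : χ i x • ρ i x (t a x) = χ i x • (Pi.single a 1 : κ → ℂ) := by
      by_cases hx : x ∈ U i
      · rw [hρt i x hx]
      · rw [image_eq_zero_of_notMem_tsupport fun h => hx (hχ i h), zero_smul, zero_smul]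
    simp_rw [h1]
    rw [← finsum_smul, χ.sum_eq_one (Set.mem_univ x), one_smul]

end QuaternionicBundle

/-! ### Complex coordinates on quaternions. -/

namespace RightQuaternion

/-- The complex coordinates `(a, b)` of a quaternion `a + j b`. -/
noncomputable def coordEquiv : RightQuaternion ≃ₗ[ℂ] ℂ × ℂ where
  toFun q := (⟨q.val.re, q.val.imI⟩, ⟨q.val.imJ, -q.val.imK⟩)
  map_add' p q := by
    exact Prod.ext (Complex.ext rfl rfl) (Complex.ext rfl (neg_add p.val.imK q.val.imK))
  map_smul' z q := by
    change ((⟨(q.val * (z : ℍ)).re, (q.val * (z : ℍ)).imI⟩,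
      ⟨(q.val * (z : ℍ)).imJ, -(q.val * (z : ℍ)).imK⟩) : ℂ × ℂ) = _
    refine Prod.ext (Complex.ext ?_ ?_) (Complex.ext ?_ ?_) <;> simp <;> ring
  invFun c := of ⟨c.1.re, c.1.im, c.2.re, -c.2.im⟩
  left_inv q := by
    change (⟨q.val.re, q.val.imI, q.val.imJ, - -q.val.imK⟩ : ℍ) = q.val
    rw [neg_neg]
    rfl
  right_inv c := by
    change ((⟨c.1.re, c.1.im⟩, ⟨c.2.re, - -c.2.im⟩) : ℂ × ℂ) = c
    rw [neg_neg]

/-- From `z j = j z̄` one gets `(a + j b) j = -b̄ + j ā`. This matches the action of the lift on a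
combination of a section and its conjugate. -/
theorem coordEquiv_mulJ (q : RightQuaternion) :
    coordEquiv (mulJ q) = (-conj (coordEquiv q).2, conj (coordEquiv q).1) := by
  change ((⟨(q.val * unitJ).re, (q.val * unitJ).imI⟩,
      ⟨(q.val * unitJ).imJ, -(q.val * unitJ).imK⟩) : ℂ × ℂ) =
    (-conj (⟨q.val.imJ, -q.val.imK⟩ : ℂ), conj (⟨q.val.re, q.val.imI⟩ : ℂ))
  refine Prod.ext (Complex.ext ?_ ?_) (Complex.ext ?_ ?_) <;> simp

/-- The complex coordinates of a tuple of quaternions. -/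
noncomputable def coordEquivPi (l : ℕ) : (Fin l → RightQuaternion) ≃ₗ[ℂ] (Fin l ⊕ Fin l → ℂ) where
  toFun q := Sum.elim (fun i => (coordEquiv (q i)).1) fun i => (coordEquiv (q i)).2
  map_add' p q := by ext (i | i) <;> simp
  map_smul' z q := by ext (i | i) <;> simp
  invFun c i := coordEquiv.symm (c (Sum.inl i), c (Sum.inr i))
  left_inv q := by ext i; simp
  right_inv c := by ext (i | i) <;> simp

instance (l : ℕ) : FiniteDimensional ℂ (Fin l → RightQuaternion) :=
  (coordEquivPi l).symm.finiteDimensional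

theorem finrank_pi (l : ℕ) : Module.finrank ℂ (Fin l → RightQuaternion) = 2 * l := by
  rw [(coordEquivPi l).finrank_eq]
  simp
  omega

/-- Componentwise right multiplication by `j`. -/
noncomputable def mulJPi (l : ℕ) :
    (Fin l → RightQuaternion) →ₛₗ[starRingEnd ℂ] (Fin l → RightQuaternion) where
  toFun q i := mulJ (q i)
  map_add' _ _ := funext fun _ => map_add _ _ _
  map_smul' _ _ := funext fun _ => LinearMap.map_smulₛₗ _ _ _

theorem mulJPi_mulJPi {l : ℕ} (q : Fin l → RightQuaternion) : mulJPi l (mulJPi l q) = -q :=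
  funext fun i => mulJ_mulJ (q i)

theorem contDiff_mulJPi (l : ℕ) {n : ℕ∞ω} : ContDiff ℝ n (mulJPi l) :=
  contDiff_pi.2 fun i => mulJL.contDiff.comp (contDiff_apply ℝ RightQuaternion i)

end RightQuaternion

/-! ### The equivariant retraction. -/

namespace QuaternionicBundle

open RightQuaternion

variable {k : ℕ} {J : Type u} [TopologicalSpace J] [ChartedSpace (EuclideanSpace ℝ (Fin k)) J]
  {r : ℕ∞} {ι : J → J} {F : Type v} [NormedAddCommGroup F] [NormedSpace ℂ F]
  {E : QuaternionicBundle.{u, v, w} (k := k) r ι F} (hι : Function.Involutive ι)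

variable (E) in
/-- The map from the trivial quaternionic bundle defined by a tuple of sections. -/
noncomputable def frameMap {l : ℕ} (s : Fin l → ∀ x, E.Fiber x) (x : J) :
    (Fin l → RightQuaternion) →ₗ[ℂ] E.Fiber x :=
  Fintype.linearCombination ℂ (E.frame hι s x) ∘ₗ (coordEquivPi l).toLinearMap

theorem frameMap_apply {l : ℕ} (s : Fin l → ∀ x, E.Fiber x) (x : J) (h : Fin l → RightQuaternion) :
    E.frameMap hι s x h = ∑ a, coordEquivPi l h a • E.frame hι s x a := rfl

theorem frameMap_involution {l : ℕ} (s : Fin l → ∀ x, E.Fiber x) (x : J)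
    (h : Fin l → RightQuaternion) :
    E.frameMap hι s (ι x) (mulJPi l h) = E.lift x (E.frameMap hι s x h) := by
  simp only [frameMap_apply, Fintype.sum_sum_type, frame, Sum.elim_inl, Sum.elim_inr, map_add,
    map_sum, LinearMap.map_smulₛₗ, conjSection_apply_involution]
  simp only [conjSection, lift_liftTo, coordEquivPi, LinearEquiv.coe_mk, LinearMap.coe_mk,
    AddHom.coe_mk, Sum.elim_inl, Sum.elim_inr, mulJPi, coordEquiv_mulJ]
  rw [add_comm]
  simp

theorem contMDiff_frameMap (hs : ContMDiff (𝓡 k) (𝓡 k) ∞ ι) {l : ℕ} {s : Fin l → ∀ x, E.Fiber x}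
    (hsm : ∀ i, ContMDiff (𝓡 k) ((𝓡 k).prod 𝓘(ℝ, F)) r fun x => (⟨x, s i x⟩ : E.Total)) :
    ContMDiff ((𝓡 k).prod 𝓘(ℝ, Fin l → RightQuaternion)) ((𝓡 k).prod 𝓘(ℝ, F)) r
      fun p : J × (Fin l → RightQuaternion) => (⟨p.1, E.frameMap hι s p.1 p.2⟩ : E.Total) := by
  simp_rw [frameMap_apply]
  refine contMDiff_total_sum contMDiff_fst _ fun a => contMDiff_total_smul ?_
    ((contMDiff_frame hι hs hsm a).comp contMDiff_fst)
  let L : (Fin l → RightQuaternion) →L[ℂ] ℂ := LinearMap.toContinuousLinearMap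
    (LinearMap.proj a ∘ₗ (coordEquivPi l).toLinearMap)
  exact ((L.restrictScalars ℝ).contMDiff).comp contMDiff_snd

/-- A tuple of sections with linearly independent frame splits off a trivial quaternionic bundle. -/
theorem exists_equivariant_retraction [T2Space J] [SigmaCompactSpace J] [IsManifold (𝓡 k) ∞ J]
    [FiniteDimensional ℂ F] (hs : ContMDiff (𝓡 k) (𝓡 k) ∞ ι) {l : ℕ}
    {s : Fin l → ∀ x, E.Fiber x}
    (hsm : ∀ i, ContMDiff (𝓡 k) ((𝓡 k).prod 𝓘(ℝ, F)) r fun x => (⟨x, s i x⟩ : E.Total))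
    (hli : ∀ x, LinearIndependent ℂ (E.frame hι s x)) :
    ∃ ρ : ∀ x, E.Fiber x →ₗ[ℂ] (Fin l → RightQuaternion),
      ContMDiff ((𝓡 k).prod 𝓘(ℝ, F)) 𝓘(ℝ, Fin l → RightQuaternion) r
        (fun p : E.Total => ρ p.proj p.2) ∧
      (∀ x h, ρ x (E.frameMap hι s x h) = h) ∧
      ∀ x v, ρ (ι x) (E.lift x v) = mulJPi l (ρ x v) := by
  classical
  obtain ⟨ρ₀, hρ₀, hρ₀s⟩ := exists_fiberwise_retraction (contMDiff_frame hι hs hsm) hli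
  let Ψ : (Fin l ⊕ Fin l → ℂ) →L[ℂ] (Fin l → RightQuaternion) :=
    LinearMap.toContinuousLinearMap (coordEquivPi l).symm.toLinearMap
  let ρ₁ (x : J) : E.Fiber x →ₗ[ℂ] (Fin l → RightQuaternion) := Ψ.toLinearMap ∘ₗ ρ₀ x
  have hρ₁ : ContMDiff ((𝓡 k).prod 𝓘(ℝ, F)) 𝓘(ℝ, Fin l → RightQuaternion) r
      (fun p : E.Total => ρ₁ p.proj p.2) :=
    (Ψ.restrictScalars ℝ).contMDiff.comp hρ₀
  have hρ₁φ (x h) : ρ₁ x (E.frameMap hι s x h) = h := by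
    rw [frameMap_apply, map_sum]
    simp only [map_smul]
    change ∑ a, coordEquivPi l h a • (coordEquivPi l).symm (ρ₀ x (E.frame hι s x a)) = h
    simp only [hρ₀s, ← map_smul, ← map_sum]
    rw [LinearEquiv.symm_apply_eq]
    ext a
    simp [Pi.single_apply]
  have hρ₁' (x : J) (v : E.Fiber x) : ρ₁ (ι (ι x)) (E.lift (ι x) (E.lift x v)) = -ρ₁ x v := by
    have := congrArg (fun p : E.Total => ρ₁ p.proj p.2) (E.lift_lift x v)
    simpa using this
  -- As `mulJPi` squares to `-1`, its inverse is its negative, so `-σ` is the conjugate of `ρ₁` by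
  -- the two lifts. The mean of `ρ₁` and `-σ` is equivariant, and it is still a retraction because
  -- `frameMap` is equivariant.
  let σ (x : J) : E.Fiber x →ₗ[ℂ] (Fin l → RightQuaternion) :=
    (mulJPi l).comp ((ρ₁ (ι x)).comp (E.lift x))
  have hσ (x v) : σ x v = mulJPi l (ρ₁ (ι x) (E.lift x v)) := rfl
  refine ⟨fun x => (2⁻¹ : ℂ) • (ρ₁ x - σ x), ?_, fun x h => ?_, fun x v => ?_⟩
  · have h1 : ContMDiff ((𝓡 k).prod 𝓘(ℝ, F)) 𝓘(ℝ, Fin l → RightQuaternion) r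
        (fun p : E.Total => σ p.proj p.2) :=
      (contDiff_mulJPi l).contMDiff.comp (hρ₁.comp E.contMDiff_lift)
    have h2 : ContDiff ℝ r fun q : Fin l → RightQuaternion => (2⁻¹ : ℂ) • q :=
      contDiff_const_smul _
    exact h2.contMDiff.comp (hρ₁.sub h1)
  · simp only [LinearMap.smul_apply, LinearMap.sub_apply, hσ, hρ₁φ, ← frameMap_involution,
      mulJPi_mulJPi, sub_neg_eq_add]
    rw [← two_smul ℂ h, smul_smul]
    norm_num
  · simp only [LinearMap.smul_apply, LinearMap.sub_apply, hσ, hρ₁', map_neg, sub_neg_eq_add,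
      LinearMap.map_smulₛₗ, map_sub, mulJPi_mulJPi, map_inv₀, map_ofNat]
    rw [add_comm]

end QuaternionicBundle

/-! ### The kernel of a surjection onto a trivial bundle. -/

/-- A right inverse splits `F` into the kernel of `R` and a copy of `V`; the kernel is isomorphic to
`W` by dimension. -/
theorem LinearMap.exists_equiv_prod_of_surjective {F V W : Type*} [AddCommGroup F] [Module ℂ F]
    [AddCommGroup V] [Module ℂ V] [AddCommGroup W] [Module ℂ W] [FiniteDimensional ℂ F]
    [FiniteDimensional ℂ W] (R : F →ₗ[ℂ] V) (hR : Function.Surjective R)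
    (hd : Module.finrank ℂ F = Module.finrank ℂ W + Module.finrank ℂ V) :
    ∃ H : F ≃ₗ[ℂ] W × V, ∀ v, (H v).2 = R v := by
  obtain ⟨g, hg⟩ := R.exists_rightInverse_of_surjective (LinearMap.range_eq_top.2 hR)
  have hg' (y) : R (g y) = y := LinearMap.congr_fun hg y
  have hker : Module.finrank ℂ (LinearMap.ker R) = Module.finrank ℂ W := by
    have := R.finrank_range_add_finrank_ker
    rw [LinearMap.range_eq_top.2 hR, finrank_top] at this
    omega
  let e₀ : LinearMap.ker R ≃ₗ[ℂ] W := LinearEquiv.ofFinrankEq _ _ hker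
  let p : F →ₗ[ℂ] LinearMap.ker R :=
    (LinearMap.id - g ∘ₗ R).codRestrict _ fun v => by simp [hg']
  have hp (v : F) : (p v : F) = v - g (R v) := rfl
  refine ⟨LinearEquiv.ofLinearMap ((e₀.toLinearMap ∘ₗ p).prod R)
    ((LinearMap.ker R).subtype ∘ₗ e₀.symm.toLinearMap ∘ₗ LinearMap.fst ℂ W V
      + g ∘ₗ LinearMap.snd ℂ W V) ?_ ?_, fun v => rfl⟩
  · refine LinearMap.ext fun y => Prod.ext ?_ ?_
    · change e₀ (p ((e₀.symm y.1 : F) + g y.2)) = y.1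
      rw [← LinearEquiv.eq_symm_apply, Subtype.ext_iff, hp, map_add, hg',
        LinearMap.mem_ker.1 (e₀.symm y.1).2, zero_add, add_sub_cancel_right]
    · change R ((e₀.symm y.1 : F) + g y.2) = y.2
      rw [map_add, hg', LinearMap.mem_ker.1 (e₀.symm y.1).2, zero_add]
  · refine LinearMap.ext fun v => ?_
    change ((e₀.symm (e₀ (p v)) : LinearMap.ker R) : F) + g (R v) = v
    rw [LinearEquiv.symm_apply_apply, hp, sub_add_cancel]

namespace QuaternionicBundle

/-- A surjective map of class `C^r` from a bundle to a trivial complex vector bundle with fibre `V`;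
the space `W` serves as model fibre for the kernel. -/
structure TrivialQuotient {k : ℕ} {J : Type u} [TopologicalSpace J]
    [ChartedSpace (EuclideanSpace ℝ (Fin k)) J] {r : ℕ∞} {ι : J → J} {F : Type v}
    [NormedAddCommGroup F] [NormedSpace ℂ F] (E : QuaternionicBundle.{u, v, w} (k := k) r ι F)
    (V W : Type*) [NormedAddCommGroup V] [NormedSpace ℂ V] [NormedAddCommGroup W]
    [NormedSpace ℂ W] where
  /-- The map on fibres. -/
  quot : ∀ x, E.Fiber x →ₗ[ℂ] V
  contMDiff_quot : ContMDiff ((𝓡 k).prod 𝓘(ℝ, F)) 𝓘(ℝ, V) r fun p : E.Total => quot p.proj p.2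
  surjective : ∀ x, Function.Surjective (quot x)
  finrank_eq : Module.finrank ℂ F = Module.finrank ℂ W + Module.finrank ℂ V

namespace TrivialQuotient

variable {k : ℕ} {J : Type u} [TopologicalSpace J] [ChartedSpace (EuclideanSpace ℝ (Fin k)) J]
  {r : ℕ∞} {ι : J → J} {F : Type v} [NormedAddCommGroup F] [NormedSpace ℂ F]
  {E : QuaternionicBundle.{u, v, w} (k := k) r ι F}
  {V W : Type*} [NormedAddCommGroup V] [NormedSpace ℂ V] [NormedAddCommGroup W] [NormedSpace ℂ W]
  (K : E.TrivialQuotient V W)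

noncomputable section

/-- The fibres of the kernel of the quotient map. -/
def Fiber (x : J) : Type w := LinearMap.ker (K.quot x)

instance (x : J) : AddCommGroup (K.Fiber x) := inferInstanceAs (AddCommGroup (LinearMap.ker _))

instance (x : J) : Module ℂ (K.Fiber x) := inferInstanceAs (Module ℂ (LinearMap.ker _))

/-- The inclusion of the kernel. -/
def incl (x : J) : K.Fiber x →ₗ[ℂ] E.Fiber x := (LinearMap.ker (K.quot x)).subtype

theorem incl_injective (x : J) : Function.Injective (K.incl x) := Subtype.val_injective

theorem quot_incl (x : J) (v : K.Fiber x) : K.quot x (K.incl x v) = 0 := LinearMap.mem_ker.1 v.2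

/-- A vector in the kernel. -/
def ofQuotEqZero {x : J} (v : E.Fiber x) (hv : K.quot x v = 0) : K.Fiber x :=
  ⟨v, LinearMap.mem_ker.2 hv⟩

theorem incl_ofQuotEqZero {x : J} (v : E.Fiber x) (hv : K.quot x v = 0) :
    K.incl x (K.ofQuotEqZero v hv) = v := rfl

/-- It transfers `lift_lift`, an equality between vectors over `ι (ι x)` and `x`, from `E` to the
kernel without any transport. -/
theorem incl_totalSpace_injective :
    Function.Injective fun p : TotalSpace W K.Fiber => (⟨p.proj, K.incl p.proj p.2⟩ : E.Total) := by
  rintro ⟨x, a⟩ ⟨y, b⟩ h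
  obtain rfl : x = y := congrArg TotalSpace.proj h
  exact congrArg _ (K.incl_injective x (E.fiber_ext h))

variable [FiniteDimensional ℂ F]

/-- The quotient map in a local trivialization. -/
def localQuot (c x : J) : F →L[ℂ] V :=
  LinearMap.toContinuousLinearMap (K.quot x ∘ₗ (trivializationAt F E.Fiber c).symmₗ ℂ x)

theorem localQuot_trivialization {c x : J} (hx : x ∈ (trivializationAt F E.Fiber c).baseSet)
    (v : E.Fiber x) :
    K.localQuot c x (trivializationAt F E.Fiber c ⟨x, v⟩).2 = K.quot x v :=
  congrArg (K.quot x) (((trivializationAt F E.Fiber c).symmₗ_apply hx _).trans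
    ((trivializationAt F E.Fiber c).symm_apply_apply_mk hx v))

variable [FiniteDimensional ℂ W]

theorem exists_adapted (c : J) : ∃ H : F ≃ₗ[ℂ] W × V, ∀ v, (H v).2 = K.localQuot c c v := by
  refine LinearMap.exists_equiv_prod_of_surjective (K.localQuot c c).toLinearMap ?_ K.finrank_eq
  intro y
  obtain ⟨v, hv⟩ := K.surjective c y
  refine ⟨(trivializationAt F E.Fiber c ⟨c, v⟩).2, ?_⟩
  rw [← hv]
  exact K.localQuot_trivialization (FiberBundle.mem_baseSet_trivializationAt' c) v

/-- A linear isomorphism that makes the quotient map at `c` a projection. -/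
def adapted (c : J) : F ≃L[ℂ] W × V := (K.exists_adapted c).choose.toContinuousLinearEquiv

theorem adapted_snd (c : J) (v : F) : (K.adapted c v).2 = K.localQuot c c v :=
  (K.exists_adapted c).choose_spec v

/-- The comparison of the quotient maps at `c` and `x` in a local trivialization at `c`. -/
def compare (c x : J) : F →L[ℂ] F :=
  ((K.adapted c).symm : W × V →L[ℂ] F) ∘L
    ((ContinuousLinearMap.fst ℂ W V ∘L (K.adapted c : F →L[ℂ] W × V)).prod (K.localQuot c x))

/-- In adapted coordinates `compare c x` keeps the `W` component and replaces the `V` component by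
the quotient map at `x`. Where it is invertible, it therefore straightens the kernel at `x` to `W ×
0`. -/
theorem adapted_compare (c x : J) (v : F) :
    K.adapted c (K.compare c x v) = ((K.adapted c v).1, K.localQuot c x v) :=
  (K.adapted c).apply_symm_apply _

theorem compare_self (c : J) : K.compare c c = 1 := by
  ext v
  apply (K.adapted c).injective
  rw [adapted_compare, ← adapted_snd]
  rfl

theorem contMDiffOn_compare [IsManifold (𝓡 k) ∞ J] (c : J) :
    ContMDiffOn (𝓡 k) 𝓘(ℝ, F →L[ℂ] F) r (K.compare c)
      (trivializationAt F E.Fiber c).baseSet := by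
  intro x hx
  refine ContMDiffWithinAt.complexClm_of_apply fun v => ?_
  have h1 : ContMDiffWithinAt (𝓡 k) 𝓘(ℝ, V) r (fun y => K.localQuot c y v)
      (trivializationAt F E.Fiber c).baseSet x := by
    refine ((K.contMDiff_quot.comp_contMDiffOn (contMDiffOn_trivialization_symm (E := E) c
      (trivializationAt F E.Fiber c).open_baseSet subset_rfl
      (contMDiffOn_const (c := v)))) x hx).congr (fun y hy => ?_) ?_
    · exact congrArg (K.quot y) ((trivializationAt F E.Fiber c).symmₗ_apply hy v)
    · exact congrArg (K.quot x) ((trivializationAt F E.Fiber c).symmₗ_apply hx v)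
  exact ((((K.adapted c).symm : W × V →L[ℂ] F).restrictScalars ℝ).contMDiff.contMDiffAt
    (x := ((K.adapted c v).1, K.localQuot c x v))).comp_contMDiffWithinAt x
      (contMDiffWithinAt_const.prodMk_space h1)

/-- The neighbourhood of `c` over which the kernel has a trivialization adapted to `c`. -/
def baseSet (c : J) : Set J :=
  (trivializationAt F E.Fiber c).baseSet ∩ K.compare c ⁻¹' {f | IsUnit f}

theorem isOpen_baseSet [IsManifold (𝓡 k) ∞ J] (c : J) : IsOpen (K.baseSet c) := by
  have : CompleteSpace F := FiniteDimensional.complete ℂ F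
  exact (K.contMDiffOn_compare c).continuousOn.isOpen_inter_preimage
    (trivializationAt F E.Fiber c).open_baseSet Units.isOpen

theorem mem_baseSet (c : J) : c ∈ K.baseSet c :=
  ⟨FiberBundle.mem_baseSet_trivializationAt' c, by
    rw [Set.mem_preimage, compare_self]
    exact isUnit_one⟩

/-- The linear coordinates on the fibres of the kernel near `c`. -/
def toModel (c x : J) : K.Fiber x →ₗ[ℂ] W :=
  LinearMap.fst ℂ W V ∘ₗ (K.adapted c).toLinearEquiv.toLinearMap ∘ₗ
    (trivializationAt F E.Fiber c).linearMapAt ℂ x ∘ₗ K.incl x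

theorem toModel_apply {c x : J} (hx : x ∈ (trivializationAt F E.Fiber c).baseSet)
    (v : K.Fiber x) :
    K.toModel c x v = (K.adapted c (trivializationAt F E.Fiber c ⟨x, K.incl x v⟩).2).1 := by
  simp only [toModel, LinearMap.comp_apply, Trivialization.linearMapAt_apply, if_pos hx]
  rfl

/-- The inverse of the linear coordinates on the fibres of the kernel near `c`, in the local
trivialization of the ambient bundle. -/
def ofModel (c x : J) : W →L[ℂ] F :=
  Ring.inverse (K.compare c x) ∘L ((K.adapted c).symm : W × V →L[ℂ] F) ∘L
    ContinuousLinearMap.inl ℂ W V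

theorem compare_ofModel {c x : J} (hx : x ∈ K.baseSet c) (y : W) :
    K.compare c x (K.ofModel c x y) = (K.adapted c).symm (y, 0) :=
  DFunLike.congr_fun (Ring.mul_inverse_cancel _ hx.2) ((K.adapted c).symm (y, 0))

theorem ofModel_eq {c x : J} (hx : x ∈ K.baseSet c) {y : W} {v : F}
    (h : K.compare c x v = (K.adapted c).symm (y, 0)) : K.ofModel c x y = v := by
  have h1 : K.ofModel c x y = Ring.inverse (K.compare c x) ((K.adapted c).symm (y, 0)) := rfl
  rw [h1, ← h]
  exact DFunLike.congr_fun (Ring.inverse_mul_cancel _ hx.2) v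

theorem adapted_compare_ofModel {c x : J} (hx : x ∈ K.baseSet c) (y : W) :
    (K.adapted c (K.ofModel c x y)).1 = y ∧ K.localQuot c x (K.ofModel c x y) = 0 := by
  have h := congrArg (K.adapted c) (K.compare_ofModel hx y)
  rw [adapted_compare, ContinuousLinearEquiv.apply_symm_apply] at h
  exact ⟨congrArg Prod.fst h, congrArg Prod.snd h⟩

theorem ofModel_toModel {c x : J} (hx : x ∈ K.baseSet c) (v : K.Fiber x) :
    K.ofModel c x (K.toModel c x v) = (trivializationAt F E.Fiber c ⟨x, K.incl x v⟩).2 := by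
  refine K.ofModel_eq hx ?_
  apply (K.adapted c).injective
  rw [adapted_compare, ContinuousLinearEquiv.apply_symm_apply, toModel_apply _ hx.1]
  refine Prod.ext rfl ?_
  exact (K.localQuot_trivialization hx.1 _).trans (K.quot_incl x v)

theorem quot_symm_ofModel {c x : J} (hx : x ∈ K.baseSet c) (y : W) :
    K.quot x ((trivializationAt F E.Fiber c).symmₗ ℂ x (K.ofModel c x y)) = 0 :=
  (K.adapted_compare_ofModel hx y).2

open Classical in
/-- The inverse of the linear coordinates on the fibres of the kernel near `c`. -/
def fiberOfModel (c x : J) (y : W) : K.Fiber x :=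
  if hx : x ∈ K.baseSet c then
    K.ofQuotEqZero ((trivializationAt F E.Fiber c).symmₗ ℂ x (K.ofModel c x y))
      (K.quot_symm_ofModel hx y)
  else 0

theorem incl_fiberOfModel {c x : J} (hx : x ∈ K.baseSet c) (y : W) :
    (trivializationAt F E.Fiber c ⟨x, K.incl x (K.fiberOfModel c x y)⟩).2 = K.ofModel c x y := by
  rw [fiberOfModel, dif_pos hx, incl_ofQuotEqZero, Trivialization.symmₗ_apply _ hx.1,
    Trivialization.apply_mk_symm _ hx.1]

theorem toModel_fiberOfModel {c x : J} (hx : x ∈ K.baseSet c) (y : W) :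
    K.toModel c x (K.fiberOfModel c x y) = y := by
  rw [toModel_apply _ hx.1, incl_fiberOfModel _ hx]
  exact (K.adapted_compare_ofModel hx y).1

theorem fiberOfModel_toModel {c x : J} (hx : x ∈ K.baseSet c) (v : K.Fiber x) :
    K.fiberOfModel c x (K.toModel c x v) = v := by
  apply K.incl_injective
  apply ((trivializationAt F E.Fiber c).linearEquivAt ℂ x hx.1).injective
  exact (K.incl_fiberOfModel hx _).trans (K.ofModel_toModel hx v)

/-- The adapted trivialization of the kernel near `c`. -/
def pretrivialization [IsManifold (𝓡 k) ∞ J] (c : J) :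
    Pretrivialization W (TotalSpace.proj : TotalSpace W K.Fiber → J) where
  toFun p := (p.proj, K.toModel c p.proj p.2)
  invFun q := ⟨q.1, K.fiberOfModel c q.1 q.2⟩
  source := TotalSpace.proj ⁻¹' K.baseSet c
  target := K.baseSet c ×ˢ Set.univ
  map_source' p hp := ⟨hp, Set.mem_univ _⟩
  map_target' q hq := hq.1
  left_inv' p hp := by
    rw [K.fiberOfModel_toModel hp]
  right_inv' q hq := by
    rw [K.toModel_fiberOfModel hq.1]
  open_target := (K.isOpen_baseSet c).prod isOpen_univ
  baseSet := K.baseSet c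
  open_baseSet := K.isOpen_baseSet c
  source_eq := rfl
  target_eq := rfl
  proj_toFun _ _ := rfl

theorem pretrivialization_symm [IsManifold (𝓡 k) ∞ J] {c x : J} (hx : x ∈ K.baseSet c) (y : W) :
    (K.pretrivialization c).symm x y = K.fiberOfModel c x y :=
  (K.pretrivialization c).symm_apply hx y

/-- This form, with the constant first component, makes the inducing condition of `VectorPrebundle`
hold by definition. -/
instance (x : J) : TopologicalSpace (K.Fiber x) :=
  TopologicalSpace.induced (fun v => (x, K.toModel x x v)) inferInstance

/-- The coordinate changes of the kernel. -/
def coordChange (c d x : J) : W →L[ℂ] W :=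
  LinearMap.toContinuousLinearMap (LinearMap.fst ℂ W V ∘ₗ
    (K.adapted d).toLinearEquiv.toLinearMap ∘ₗ (trivializationAt F E.Fiber d).linearMapAt ℂ x ∘ₗ
    (trivializationAt F E.Fiber c).symmₗ ℂ x ∘ₗ (K.ofModel c x).toLinearMap)

theorem coordChange_apply {c d x : J} (hc : x ∈ K.baseSet c) (y : W) :
    K.coordChange c d x y = K.toModel d x (K.fiberOfModel c x y) := by
  rw [fiberOfModel, dif_pos hc]
  rfl

theorem contMDiffOn_ofModel [IsManifold (𝓡 k) ∞ J] (c : J) :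
    ContMDiffOn (𝓡 k) 𝓘(ℝ, W →L[ℂ] F) r (K.ofModel c) (K.baseSet c) := by
  intro x hx
  refine ContMDiffWithinAt.complexClm_of_apply fun y => ?_
  exact (((K.contMDiffOn_compare c).mono Set.inter_subset_left x hx).ringInverse
    hx.2).complexClm_apply contMDiffWithinAt_const

/-- The change of coordinates passes through `E`: embed by `ofModel c`, change the trivialization of
`E`, then project linearly to `W`. -/
theorem contMDiffOn_coordChange [IsManifold (𝓡 k) ∞ J] (c d : J) :
    ContMDiffOn (𝓡 k) 𝓘(ℝ, W →L[ℂ] W) r (K.coordChange c d) (K.baseSet c ∩ K.baseSet d) := by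
  have hopen : IsOpen (K.baseSet c ∩ K.baseSet d) := (K.isOpen_baseSet c).inter (K.isOpen_baseSet d)
  intro x hx
  refine ContMDiffWithinAt.complexClm_of_apply fun y => ?_
  have h1 : ContMDiffOn (𝓡 k) 𝓘(ℝ, F) r (fun x => K.ofModel c x y)
      (K.baseSet c ∩ K.baseSet d) := fun x hx =>
    (((K.contMDiffOn_ofModel c).mono Set.inter_subset_left) x hx).complexClm_apply
      contMDiffWithinAt_const
  have h2 := ((trivializationAt F E.Fiber d).contMDiffOn_section_iff hopen
    (fun x hx => hx.2.1)).1 (contMDiffOn_trivialization_symm (E := E) c hopen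
      (fun x hx => hx.1.1) h1)
  have h3 : ContMDiff 𝓘(ℝ, F) 𝓘(ℝ, W) r fun v : F => (K.adapted d v).1 :=
    (((ContinuousLinearMap.fst ℂ W V) ∘L (K.adapted d : F →L[ℂ] W × V)).restrictScalars ℝ).contMDiff
  refine (h3.comp_contMDiffOn h2).congr (fun z hz => ?_) x hx
  rw [coordChange_apply _ hz.1, toModel_apply _ hz.2.1, fiberOfModel, dif_pos hz.1,
    incl_ofQuotEqZero, Trivialization.symmₗ_apply _ hz.1.1]
  rfl

/-- The vector bundle structure of the kernel. -/
def prebundle [IsManifold (𝓡 k) ∞ J] : VectorPrebundle ℂ W K.Fiber where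
  pretrivializationAtlas := Set.range K.pretrivialization
  pretrivialization_linear' := by
    rintro _ ⟨c, rfl⟩
    exact ⟨fun x _ => (K.toModel c x).isLinear⟩
  pretrivializationAt := K.pretrivialization
  mem_base_pretrivializationAt := K.mem_baseSet
  pretrivialization_mem_atlas c := ⟨c, rfl⟩
  exists_coordChange := by
    rintro _ ⟨c, rfl⟩ _ ⟨d, rfl⟩
    refine ⟨K.coordChange c d, (K.contMDiffOn_coordChange c d).continuousOn, fun x hx y => ?_⟩
    rw [coordChange_apply _ hx.1, pretrivialization_symm _ hx.1]
    rfl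
  totalSpaceMk_isInducing _ := ⟨rfl⟩

variable [IsManifold (𝓡 k) ∞ J]

instance : TopologicalSpace (TotalSpace W K.Fiber) := K.prebundle.totalSpaceTopology

instance : FiberBundle W K.Fiber := K.prebundle.toFiberBundle

instance : VectorBundle ℂ W K.Fiber := K.prebundle.toVectorBundle

instance : ContMDiffVectorBundle r W K.Fiber (𝓡 k) where
  contMDiffOn_coordChangeL := by
    intro e e' he he'
    obtain ⟨_, ⟨c, rfl⟩, hc⟩ := he.out
    obtain ⟨_, ⟨d, rfl⟩, hd⟩ := he'.out
    have hcb : e.baseSet = K.baseSet c := by rw [hc]; rfl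
    have hdb : e'.baseSet = K.baseSet d := by rw [hd]; rfl
    rw [hcb, hdb]
    refine ((ContinuousLinearMap.restrictScalarsL ℂ W W ℝ ℝ).contMDiff.comp_contMDiffOn
      (K.contMDiffOn_coordChange c d)).congr fun x hx => ?_
    ext y
    rw [ContinuousLinearEquiv.coe_coe, Trivialization.coordChangeL_apply _ _ (by rwa [hcb, hdb])]
    change _ = K.coordChange c d x y
    rw [coordChange_apply _ hx.1, ← pretrivialization_symm _ hx.1, hc, hd]
    rfl

end

end TrivialQuotient

/-! ### The direct sum decomposition. -/

section Projections

variable {k : ℕ} {J : Type u} [TopologicalSpace J] [ChartedSpace (EuclideanSpace ℝ (Fin k)) J]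
  {r : ℕ∞} {ι : J → J} {F : Type*} [NormedAddCommGroup F] [NormedSpace ℂ F]
  {F' : Type*} [NormedAddCommGroup F'] [NormedSpace ℂ F']

theorem contMDiff_prod_fst (E : QuaternionicBundle (k := k) r ι F)
    (E' : QuaternionicBundle (k := k) r ι F') :
    ContMDiff ((𝓡 k).prod 𝓘(ℝ, F × F')) ((𝓡 k).prod 𝓘(ℝ, F)) r
      fun p : (E.prod E').Total => (⟨p.proj, p.2.1⟩ : E.Total) := by
  intro p
  have h := contMDiffAt_totalSpace.1
    (contMDiffAt_id (I := (𝓡 k).prod 𝓘(ℝ, F × F')) (n := r) (x := p))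
  refine contMDiffAt_totalSpace.2 ⟨h.1, ?_⟩
  exact ((ContinuousLinearMap.fst ℝ F F').contMDiff (n := r)).contMDiffAt.comp
    (I' := 𝓘(ℝ, F × F')) p h.2

theorem contMDiff_prod_snd (E : QuaternionicBundle (k := k) r ι F)
    (E' : QuaternionicBundle (k := k) r ι F') :
    ContMDiff ((𝓡 k).prod 𝓘(ℝ, F × F')) ((𝓡 k).prod 𝓘(ℝ, F')) r
      fun p : (E.prod E').Total => (⟨p.proj, p.2.2⟩ : E'.Total) := by
  intro p
  have h := contMDiffAt_totalSpace.1
    (contMDiffAt_id (I := (𝓡 k).prod 𝓘(ℝ, F × F')) (n := r) (x := p))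
  refine contMDiffAt_totalSpace.2 ⟨h.1, ?_⟩
  exact ((ContinuousLinearMap.snd ℝ F F').contMDiff (n := r)).contMDiffAt.comp
    (I' := 𝓘(ℝ, F × F')) p h.2

end Projections

namespace TrivialQuotient

variable {k : ℕ} {J : Type u} [TopologicalSpace J] [ChartedSpace (EuclideanSpace ℝ (Fin k)) J]
  {r : ℕ∞} {ι : J → J} {F : Type v} [NormedAddCommGroup F] [NormedSpace ℂ F]
  {E : QuaternionicBundle.{u, v, w} (k := k) r ι F}
  {V W : Type*} [NormedAddCommGroup V] [NormedSpace ℂ V] [NormedAddCommGroup W] [NormedSpace ℂ W]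
  (K : E.TrivialQuotient V W) [FiniteDimensional ℂ F] [FiniteDimensional ℂ W] [IsManifold (𝓡 k) ∞ J]

/-- In adapted coordinates the inclusion is `(x, y) ↦ ofModel c x y`. -/
theorem contMDiff_incl :
    ContMDiff ((𝓡 k).prod 𝓘(ℝ, W)) ((𝓡 k).prod 𝓘(ℝ, F)) r
      fun p : TotalSpace W K.Fiber => (⟨p.proj, K.incl p.proj p.2⟩ : E.Total) := by
  intro p
  have h := contMDiffAt_totalSpace.1
    (contMDiffAt_id (I := (𝓡 k).prod 𝓘(ℝ, W)) (n := r) (x := p))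
  have hb : ContMDiffAt ((𝓡 k).prod 𝓘(ℝ, W)) (𝓡 k) r
    (fun q : TotalSpace W K.Fiber => q.proj) p := h.1
  refine contMDiffAt_totalSpace.2 ⟨hb, ?_⟩
  have hmem : K.baseSet p.proj ∈ 𝓝 p.proj := (K.isOpen_baseSet _).mem_nhds (K.mem_baseSet _)
  have h1 : ContMDiffAt ((𝓡 k).prod 𝓘(ℝ, W)) 𝓘(ℝ, W →L[ℂ] F) r
      (fun q : TotalSpace W K.Fiber => K.ofModel p.proj q.proj) p :=
    ((K.contMDiffOn_ofModel p.proj).contMDiffAt hmem).comp p hb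
  have h2 : ContMDiffAt ((𝓡 k).prod 𝓘(ℝ, W)) 𝓘(ℝ, W) r
      (fun q : TotalSpace W K.Fiber => K.toModel p.proj q.proj q.2) p := h.2
  have h3 := (ContMDiffWithinAt.complexClm_apply (s := Set.univ) h1 h2).contMDiffAt Filter.univ_mem
  refine h3.congr_of_eventuallyEq ?_
  filter_upwards [hb.continuousAt hmem] with q hq
  exact (K.ofModel_toModel hq q.2).symm

/-- The coordinate of a kernel vector is a fixed linear function of its coordinate in `E`, so
regularity can be tested after inclusion. -/
theorem contMDiff_of_incl {EM : Type*} [NormedAddCommGroup EM] [NormedSpace ℝ EM] {HM : Type*}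
    [TopologicalSpace HM] {IM : ModelWithCorners ℝ EM HM} {M : Type*} [TopologicalSpace M]
    [ChartedSpace HM M] {b : M → J} {f : ∀ p, K.Fiber (b p)}
    (hf : ContMDiff IM ((𝓡 k).prod 𝓘(ℝ, F)) r
      fun p => (⟨b p, K.incl (b p) (f p)⟩ : E.Total)) :
    ContMDiff IM ((𝓡 k).prod 𝓘(ℝ, W)) r fun p => (⟨b p, f p⟩ : TotalSpace W K.Fiber) := by
  intro p
  have h := contMDiffAt_totalSpace.1 (hf p)
  refine contMDiffAt_totalSpace.2 ⟨h.1, ?_⟩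
  have h1 : ContMDiff 𝓘(ℝ, F) 𝓘(ℝ, W) r fun v : F => (K.adapted (b p) v).1 :=
    (((ContinuousLinearMap.fst ℂ W V) ∘L
      (K.adapted (b p) : F →L[ℂ] W × V)).restrictScalars ℝ).contMDiff
  refine (h1.contMDiffAt.comp p h.2).congr_of_eventuallyEq ?_
  filter_upwards [h.1.continuousAt ((trivializationAt F E.Fiber (b p)).open_baseSet.mem_nhds
    (FiberBundle.mem_baseSet_trivializationAt' (b p)))] with q hq
  exact K.toModel_apply hq (f q)

/-- The kernel as a quaternionic bundle, if it is invariant under the lift of the involution. -/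
noncomputable def bundle
    (hlift : ∀ x v, K.quot x v = 0 → K.quot (ι x) (E.lift x v) = 0) :
    QuaternionicBundle (k := k) r ι W where
  Fiber := K.Fiber
  lift x :=
    { toFun := fun a => K.ofQuotEqZero (E.lift x (K.incl x a)) (hlift x _ (K.quot_incl x a))
      map_add' := fun a b => K.incl_injective _ (by simp only [incl_ofQuotEqZero, map_add])
      map_smul' := fun z a => K.incl_injective _ (by
        simp only [incl_ofQuotEqZero, map_smul, LinearMap.map_smulₛₗ]) }
  contMDiff_lift := K.contMDiff_of_incl (E.contMDiff_lift.comp K.contMDiff_incl)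
  lift_lift x a := K.incl_totalSpace_injective (by
    change (⟨ι (ι x), E.lift (ι x) (E.lift x (K.incl x a))⟩ : E.Total) = ⟨x, K.incl x (-a)⟩
    rw [E.lift_lift, map_neg])

/-- A bundle with an equivariant retraction onto a trivial quaternionic subbundle is the direct sum
of the kernel and the trivial bundle. -/
theorem nonempty_iso_bundle_prod_trivial (hι : Function.Involutive ι)
    (hs : ContMDiff (𝓡 k) (𝓡 k) ∞ ι) {l : ℕ}
    (K : E.TrivialQuotient (Fin l → RightQuaternion) W)
    (hlift : ∀ x v, K.quot x v = 0 → K.quot (ι x) (E.lift x v) = 0)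
    (hequiv : ∀ x v, K.quot (ι x) (E.lift x v) = RightQuaternion.mulJPi l (K.quot x v))
    (g : ∀ x, (Fin l → RightQuaternion) →ₗ[ℂ] E.Fiber x)
    (hg : ContMDiff ((𝓡 k).prod 𝓘(ℝ, Fin l → RightQuaternion)) ((𝓡 k).prod 𝓘(ℝ, F)) r
      fun p : J × (Fin l → RightQuaternion) => (⟨p.1, g p.1 p.2⟩ : E.Total))
    (hgι : ∀ x h, g (ι x) (RightQuaternion.mulJPi l h) = E.lift x (g x h))
    (hKg : ∀ x h, K.quot x (g x h) = h) :
    Nonempty (E.Iso ((K.bundle hlift).prod (QuaternionicBundle.trivial hι hs l))) := by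
  have hker (x) (v : E.Fiber x) : K.quot x (v - g x (K.quot x v)) = 0 := by
    rw [map_sub, hKg, sub_self]
  let e (x : J) : E.Fiber x ≃ₗ[ℂ] K.Fiber x × (Fin l → RightQuaternion) :=
    { toFun := fun v => (K.ofQuotEqZero _ (hker x v), K.quot x v)
      invFun := fun a => K.incl x a.1 + g x a.2
      map_add' := fun a b => Prod.ext (K.incl_injective x (by
        simp only [incl_ofQuotEqZero, map_add, Prod.fst_add]; abel)) (map_add _ _ _)
      map_smul' := fun z a => Prod.ext (K.incl_injective x (by
        simp only [incl_ofQuotEqZero, map_smul, Prod.smul_fst, smul_sub, RingHom.id_apply]))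
        (map_smul _ _ _)
      left_inv := fun v => by
        change v - g x (K.quot x v) + g x (K.quot x v) = v
        rw [sub_add_cancel]
      right_inv := fun a => by
        have h : K.quot x (K.incl x a.1 + g x a.2) = a.2 := by
          rw [map_add, quot_incl, hKg, zero_add]
        refine Prod.ext (K.incl_injective x ?_) h
        rw [incl_ofQuotEqZero, h, add_sub_cancel_right] }
  refine ⟨⟨e, ?_, ?_, ?_⟩⟩
  · have h₁ : ContMDiff ((𝓡 k).prod 𝓘(ℝ, F)) ((𝓡 k).prod 𝓘(ℝ, F)) r
        fun p : E.Total => (⟨p.proj, g p.proj (K.quot p.proj p.2)⟩ : E.Total) :=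
      hg.comp ((contMDiff_proj E.Fiber).prodMk K.contMDiff_quot)
    have h₂ : ContMDiff ((𝓡 k).prod 𝓘(ℝ, F)) ((𝓡 k).prod 𝓘(ℝ, F)) r
        fun p : E.Total => (⟨p.proj, p.2 - g p.proj (K.quot p.proj p.2)⟩ : E.Total) := by
      refine (contMDiff_total_add (f := fun p : E.Total => p.2) contMDiff_id
        (contMDiff_total_smul (c := fun _ => (-1 : ℂ)) contMDiff_const h₁)).congr fun p => ?_
      rw [neg_one_smul, sub_eq_add_neg]
    have h₃ : ContMDiff ((𝓡 k).prod 𝓘(ℝ, F)) ((𝓡 k).prod 𝓘(ℝ, W)) r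
        fun p : E.Total =>
          (⟨p.proj, K.ofQuotEqZero _ (hker p.proj p.2)⟩ : TotalSpace W K.Fiber) :=
      K.contMDiff_of_incl h₂
    intro p
    have k₁ := contMDiffAt_totalSpace.1 (h₃ p)
    exact contMDiffAt_totalSpace.2 ⟨k₁.1, k₁.2.prodMk_space (K.contMDiff_quot p)⟩
  · have h₁ : ContMDiff ((𝓡 k).prod 𝓘(ℝ, W × (Fin l → RightQuaternion)))
        ((𝓡 k).prod 𝓘(ℝ, W)) r
        fun p : ((K.bundle hlift).prod (QuaternionicBundle.trivial hι hs l)).Total =>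
          (⟨p.proj, p.2.1⟩ : TotalSpace W K.Fiber) :=
      contMDiff_prod_fst (K.bundle hlift) (QuaternionicBundle.trivial hι hs l)
    have h₂ : ContMDiff ((𝓡 k).prod 𝓘(ℝ, W × (Fin l → RightQuaternion)))
        𝓘(ℝ, Fin l → RightQuaternion) r
        fun p : ((K.bundle hlift).prod (QuaternionicBundle.trivial hι hs l)).Total =>
          (p.2.2 : Fin l → RightQuaternion) := fun p =>
      (contMDiffAt_totalSpace.1 (contMDiff_prod_snd (K.bundle hlift)
        (QuaternionicBundle.trivial hι hs l) p)).2
    exact contMDiff_total_add (K.contMDiff_incl.comp h₁)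
      (hg.comp ((contMDiff_proj _).prodMk h₂))
  · intro x a
    refine Prod.ext (K.incl_injective _ ?_) (hequiv x a)
    change E.lift x a - g (ι x) (K.quot (ι x) (E.lift x a)) = E.lift x (a - g x (K.quot x a))
    rw [hequiv, hgι, map_sub]

end TrivialQuotient

end QuaternionicBundle

/-! ### Conclusion. -/

theorem corollary2p6 {J : Type u} [TopologicalSpace J] [T2Space J] [SecondCountableTopology J]
    {k n m μ : ℕ} [ChartedSpace (EuclideanSpace ℝ (Fin k)) J] [IsManifold (𝓡 k) ∞ J]
    (hk : (k : ℤ) = 4 * (n : ℤ) - (μ : ℤ)) (hμ : μ ≤ 3)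
    (ι : J → J) (hι : Function.Involutive ι) (hs : ContMDiff (𝓡 k) (𝓡 k) ∞ ι)
    (hfix : (Function.fixedPoints ι).Nonempty) (hiso : DiscreteTopology (Function.fixedPoints ι))
    (r : ℕ∞) {F : Type v} [NormedAddCommGroup F] [NormedSpace ℂ F] [FiniteDimensional ℂ F]
    (hrank : Module.finrank ℂ F = 2 * m) (hmn : 2 * n ≤ 2 * m)
    (E : QuaternionicBundle.{u, v, w} (k := k) r ι F) :
    ∃ Q : QuaternionicBundle.{u, 0, w} (k := k) r ι (EuclideanSpace ℂ (Fin (2 * n))),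
      Nonempty (E.Iso (Q.prod (QuaternionicBundle.trivial hι hs (m - n)))) := by
  have : LocallyCompactSpace J := ChartedSpace.locallyCompactSpace (EuclideanSpace ℝ (Fin k)) J
  -- The codimension condition reads `k + 4 * (m - n) < 4 * m + 2`, that is `k < 4 * n + 2`.
  obtain ⟨s, hsm, hli⟩ := E.exists_linearIndependent_frame hι hs hiso (l := m - n)
    (by omega) (by omega)
  obtain ⟨ρ, hρ, hρg, hρι⟩ := E.exists_equivariant_retraction hι hs hsm hli
  let K : E.TrivialQuotient (Fin (m - n) → RightQuaternion) (EuclideanSpace ℂ (Fin (2 * n))) :=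
    { quot := ρ
      contMDiff_quot := hρ
      surjective := fun x h => ⟨_, hρg x h⟩
      finrank_eq := by
        rw [hrank, finrank_euclideanSpace_fin, RightQuaternion.finrank_pi]
        omega }
  have hlift (x : J) (v : E.Fiber x) (hv : ρ x v = 0) : ρ (ι x) (E.lift x v) = 0 := by
    rw [hρι, hv, map_zero]
  exact ⟨K.bundle hlift, K.nonempty_iso_bundle_prod_trivial hι hs hlift hρι _
    (E.contMDiff_frameMap hι hs hsm) (E.frameMap_involution hι s) hρg⟩
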